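/- **Setting.** Let $d\ge 1$, write $\mathbf v=(v_x,v_\perp)\in\mathbb R\times\mathbb R^{d-1}$ and let $\mathbf i$ be the unit vector in the $x$-direction. A cylinder parallel to the $x$-axis, whose left and right ends are $(d-1)$-dimensional discs of radius $r>0$, moves horizontally with velocity $W(t)$, $t\ge0$. Let $0\le V_\infty$, $0<p\le 2$, $\gamma_0>0$, and let $f_0(\mathbf v)=a_0(v_x)b(v_\perp)$, $K(\mathbf v,\mathbf u)=k(v_x,u_x)b(v_\perp)$ with $a_0,b,k$ nonnegative and continuous, $a_0$ and $k$ even in each variable, $f_0$ bounded, $\int b=1$, $b(0)>0$, $\int_{v_x\ge0}v_xK(\mathbf v,\mathbf u)\,d\mathbf v=|u_x|$, and assume: * $\sup_{|u|\le\gamma_0}\sup_{v\in\mathbb R}k(v,u)<\infty$; * $m(u)=\int_0^\infty v^2k(v,u)\,dv$ is finite, $C^1$ for $u\ne0$ and strictly decreasing for $u<0$, and $c|u|^p\le m(u)\le C'|u|^p$ for $|u|\le\gamma_0$, with some $c,C'>0$; * there is $M\in L^1(\mathbb R)$ with $k(v,z-y-V_\infty)a_0(z)\le M(z)$ for $|v|<2\gamma_0$,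 $|y|<\gamma_0$, $z\in\mathbb R$. Put $\ell(\mathbf w)=w_x^2+\int_{v_x\ge0}v_x^2K(\mathbf v,\mathbf w)\,d\mathbf v$ and, with $|\partial\Omega_L|$ the measure of an end, $$F_0(V)=|\partial\Omega_L|\Big(\int_{u_x\le V}-\int_{u_x\ge V}\Big)\ell(\mathbf u-\mathbf iV)f_0(\mathbf u)\,d\mathbf u .$$ Assume that these integrals converge and that $F_0$ is $C^1$ for $|V-V_\infty|<\gamma_0$. For $0<\gamma<\gamma_0$ let $B_0$ and $B_\infty$ be the maximum and the minimum of $F_0'$ on $[V_\infty-\gamma,V_\infty+\gamma]$. **Precollision force.** For a point $\mathbf x$ of an end of the body at time $t$, with transversal coordinate $x_\perp$, and a velocity $\mathbf u$, a precollision is a time $s\in(0,t)$ with $\int_s^tW=(t-s)u_x$ and $|x_\perp-(t-s)u_\perp|\le r$. If there is one, let $\tau$ be the most recent and $\xi$ the point of the same end with transversal coordinate $x_\perp-(t-\tau)u_\perp$. On each end the densities after and before collision are given by $$f_+(t,\mathbf x;\mathbf v)=\int K(\mathbf v-\mathbf iW(t),\mathbf u-\mathbf iW(t))f_-(t,\mathbf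 x;\mathbf u)\,d\mathbf u,\qquad f_-(t,\mathbf x;\mathbf u)=\begin{cases}f_+(\tau,\xi;\mathbf u)&\text{if there is a precollision},\\ f_0(\mathbf u)&\text{otherwise},\end{cases}$$ the integral being over $u_x\ge W(t)$ on the left end and over $u_x\le W(t)$ on the right end; $f_+$ is the least nonnegative solution. (If precollision times accumulate at $t$, which forces $u_x=W(t)$ and so concerns only a null set of velocities, $f_-=f_0$.) The precollision force is $$R_W(t)=\int_{\partial\Omega_L(t)}\!dS\int_{u_x\ge W(t)}\!\ell(\mathbf u-\mathbf iW(t))\{f_0-f_-\}\,d\mathbf u+\int_{\partial\Omega_R(t)}\!dS\int_{u_x\le W(t)}\!\ell(\mathbf u-\mathbf iW(t))\{f_--f_0\}\,d\mathbf u .$$ **Reversal class.** For $\gamma\in(0,1)$, $A_+,A_->0$ and $K_0\in[1/B_0,2/B_0]$ put $t_0=K_0|\ln\gamma|$. Let $\mathcal W$ be the class of Lipschitz $W:[0,\infty)\to\mathbb R$ with $W(0)=V_\infty+\gamma$ that are nonincreasing on $[0,t_0]$ and satisfy for all $t\ge0$ $$V_\infty+\gamma e^{-B_0t}-\frac{\gamma^{p+1}A_+}{(1+t)^{p+d}}\le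 W(t)\le V_\infty+\gamma e^{-B_\infty t}-\frac{\gamma^{p+1}A_-}{t^{p+d}}\chi\{t\ge t_0+1\}.$$ **Theorem.** Assume the Reversal Criterion $\int_0^\infty k(0,z)a_0(z+V_\infty)\,dz<a_0(V_\infty)$. Then there are constants $c_1,C_2,C,\varepsilon>0$, independent of $A_\pm,\gamma,K_0,W,t$, such that for all $A_+,A_->0$ there is $\gamma_1>0$ such that for all $\gamma\in(0,\gamma_1)$, all $K_0\in[1/B_0,2/B_0]$, all $W\in\mathcal W$ and all $t\ge0$ the integrals defining $R_W(t)$ converge absolutely and $$R_W(t)\ \ge\ \Big(\frac{c_1\gamma^{p+1}}{t^{p+d}}-\frac{C_2\gamma^{(1+\varepsilon)(p+1)}A_+^{p+1}}{t^{p+d}}\Big)\chi\{t\ge t_0\}\ \ge\ 0,\qquad R_W(t)\ \le\ \frac{C(\gamma+\gamma^{p+1}A_+)^{p+1}}{(1+t)^{p+d}} .$$ -/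

import Mathlib

open Set MeasureTheory
open scoped ENNReal

noncomputable section

/-- The transversal space `ℝ^{d-1}`. -/
abbrev Perp (d : ℕ) : Type := EuclideanSpace ℝ (Fin (d - 1))

/-- The velocity space `ℝ^d = ℝ × ℝ^{d-1}`; a velocity is a pair `(v_x, v_⊥)`. -/
abbrev Vel (d : ℕ) : Type := ℝ × Perp d

/-- The horizontal vector `𝐢 V`. -/
def horiz (d : ℕ) (V : ℝ) : Vel d := (V, 0)

/-- The initial particle density `f₀(v) = a₀(v_x) b(v_⊥)`. -/
def initialDensity {d : ℕ} (a₀ : ℝ → ℝ) (b : Perp d → ℝ) (v : Vel d) : ℝ := a₀ v.1 * b v.2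

/-- The collision kernel `K(v, u) = k(v_x, u_x) b(v_⊥)`. -/
def collisionKernel {d : ℕ} (k : ℝ → ℝ → ℝ) (b : Perp d → ℝ) (v u : Vel d) : ℝ :=
  k v.1 u.1 * b v.2

/-- `∫_{v ≥ 0} v² k(v, u) dv`. -/
def secondMoment (k : ℝ → ℝ → ℝ) (u : ℝ) : ℝ := ∫ v in Ici (0 : ℝ), v ^ 2 * k v u

/-- `ℓ(w) = w_x² + ∫_{v_x ≥ 0} v_x² K(v, w) dv`. -/
def ell {d : ℕ} (K : Vel d → Vel d → ℝ) (w : Vel d) : ℝ :=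
  w.1 ^ 2 + ∫ v in {v : Vel d | 0 ≤ v.1}, v.1 ^ 2 * K v w

/-- The standing assumptions on the collision kernel and on the initial density: structure,
conservation of mass, boundedness, power law with exponent `p`, integrability.  The number `γ₀` is
the size of the neighbourhoods in which the last three are required. -/
structure GasAssumptions {d : ℕ} (k : ℝ → ℝ → ℝ) (a₀ : ℝ → ℝ) (b : Perp d → ℝ)
    (p Vinf γ₀ : ℝ) : Prop where
  k_nonneg : ∀ v u, 0 ≤ k v u
  a₀_nonneg : ∀ u, 0 ≤ a₀ u
  b_nonneg : ∀ y, 0 ≤ b y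
  k_continuous : Continuous (Function.uncurry k)
  a₀_continuous : Continuous a₀
  b_continuous : Continuous b
  k_even_left : ∀ v u, k (-v) u = k v u
  k_even_right : ∀ v u, k v (-u) = k v u
  a₀_even : ∀ u, a₀ (-u) = a₀ u
  b_integral : ∫ y, b y = 1
  b_zero : 0 < b 0
  f₀_bounded : ∃ M, ∀ v : Vel d, initialDensity a₀ b v ≤ M
  mass_integrable : ∀ u : Vel d,
    IntegrableOn (fun v : Vel d => v.1 * collisionKernel k b v u) {v : Vel d | 0 ≤ v.1}
  mass_conservation : ∀ u : Vel d,
    ∫ v in {v : Vel d | 0 ≤ v.1}, v.1 * collisionKernel k b v u = |u.1|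
  bounded : ∃ M, ∀ v u, |u| ≤ γ₀ → k v u ≤ M
  p_pos : 0 < p
  p_le_two : p ≤ 2
  moment_integrable : ∀ u, IntegrableOn (fun v : ℝ => v ^ 2 * k v u) (Ici 0)
  power_law : ∃ c C : ℝ, 0 < c ∧ 0 < C ∧ ∀ u, |u| ≤ γ₀ →
    c * |u| ^ p ≤ secondMoment k u ∧ secondMoment k u ≤ C * |u| ^ p
  moment_contDiff : ContDiffOn ℝ 1 (secondMoment k) {u | u ≠ 0}
  moment_strictAnti : StrictAntiOn (secondMoment k) (Iio 0)
  domination : ∃ M : ℝ → ℝ, Integrable M ∧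
    ∀ v y z, |v| < 2 * γ₀ → |y| < γ₀ → k v (z - y - Vinf) * a₀ z ≤ M z

/-- The Reversal Criterion. -/
def ReversalCriterion (k : ℝ → ℝ → ℝ) (a₀ : ℝ → ℝ) (Vinf : ℝ) : Prop :=
  ∫ z in Ioi (0 : ℝ), k 0 z * a₀ (z + Vinf) < a₀ Vinf

/-- The force `F₀(V)` on the body moving with velocity `V` if no particle collides more than
once.  Both ends of the cylinder are discs of radius `r` in `ℝ^{d-1}`. -/
def freeForce {d : ℕ} (K : Vel d → Vel d → ℝ) (f₀ : Vel d → ℝ) (r V : ℝ) : ℝ :=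
  (∫ _y in Metric.closedBall (0 : Perp d) r,
      ∫ u in {u : Vel d | u.1 ≤ V}, ell K (u - horiz d V) * f₀ u)
    - ∫ _y in Metric.closedBall (0 : Perp d) r,
        ∫ u in {u : Vel d | V ≤ u.1}, ell K (u - horiz d V) * f₀ u

/-- The two ends of the cylinder. -/
inductive Side
  | left
  | right

/-- Velocities of particles which hit the given end of a body moving with velocity `V`. -/
def Side.incoming (d : ℕ) (V : ℝ) : Side → Set (Vel d)
  | Side.left => {u | V ≤ u.1}
  | Side.right => {u | u.1 ≤ V}

/-- A particle of velocity `u` is, at time `t`, at the point with transversal coordinate `y` of an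
end of the body.  These are the times `s ∈ (0, t)` at which its straight trajectory, followed
backwards, is on the same end: since the body has travelled `∫_s^t W`, this means
`(t - s) u_x = ∫_s^t W` and `y - (t - s) u_⊥` lies in the disc of radius `r`. -/
def precollisionTimes {d : ℕ} (r : ℝ) (W : ℝ → ℝ) (t : ℝ) (y : Perp d) (u : Vel d) : Set ℝ :=
  {s | s ∈ Ioo 0 t ∧ (∫ σ in s..t, W σ) = (t - s) * u.1 ∧ ‖y - (t - s) • u.2‖ ≤ r}

/-- The time of the most recent precollision. -/
def lastPrecollision {d : ℕ} (r : ℝ) (W : ℝ → ℝ) (t : ℝ) (y : Perp d) (u : Vel d) : ℝ :=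
  sSup (precollisionTimes r W t y u)

/-- Densities on an end of the body: functions of the time, of the transversal coordinate of the
point and of the velocity. -/
abbrev EndDensity (d : ℕ) : Type := ℝ → Perp d → Vel d → ℝ≥0∞

open Classical in
/-- The density before collision generated by a density `fp` after collision: `f` is constant along
trajectories, so `f₋(t, x; u) = fp(τ, ξ; u)` if there is a precollision, the most recent one being
at time `τ` and position `ξ`, and `f₋(t, x; u) = f₀(u)` otherwise.  (If precollision times
accumulate at `t`, then `u_x = W(t)`; this is a null set of velocities.) -/
def transport {d : ℕ} (f₀ : Vel d → ℝ) (r : ℝ) (W : ℝ → ℝ) (fp : EndDensity d) :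
    EndDensity d := fun t y u =>
  if (precollisionTimes r W t y u).Nonempty ∧ lastPrecollision r W t y u < t then
    fp (lastPrecollision r W t y u) (y - (t - lastPrecollision r W t y u) • u.2) u
  else ENNReal.ofReal (f₀ u)

/-- The law of reflection
`f₊(t, x; v) = ∫ K(v - 𝐢 W(t); u - 𝐢 W(t)) f₋(t, x; u) du`,
with the integral over the velocities that hit the given end. -/
def reflect {d : ℕ} (K : Vel d → Vel d → ℝ) (W : ℝ → ℝ) (e : Side) (fm : EndDensity d) :
    EndDensity d := fun t y v =>
  ∫⁻ u in e.incoming d (W t),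
    ENNReal.ofReal (K (v - horiz d (W t)) (u - horiz d (W t))) * fm t y u

/-- One step "transport, then reflect", as a monotone map. -/
def reflectTransport {d : ℕ} (K : Vel d → Vel d → ℝ) (f₀ : Vel d → ℝ) (r : ℝ) (W : ℝ → ℝ)
    (e : Side) : EndDensity d →o EndDensity d where
  toFun fp := reflect K W e (transport f₀ r W fp)
  monotone' := by
    intro f g hfg t y v
    refine lintegral_mono fun u => ?_
    refine mul_le_mul_right ?_ _
    unfold transport
    split_ifs
    · exact hfg _ _ _
    · exact le_rfl

/-- The density `f₊` after collision on an end of the body moving with velocity `W`: the (least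
nonnegative) solution of the law of reflection. -/
def fPlus {d : ℕ} (K : Vel d → Vel d → ℝ) (f₀ : Vel d → ℝ) (r : ℝ) (W : ℝ → ℝ) (e : Side) :
    EndDensity d :=
  OrderHom.lfp (reflectTransport K f₀ r W e)

/-- The density `f₋` before collision on an end of the body moving with velocity `W`. -/
def fMinus {d : ℕ} (K : Vel d → Vel d → ℝ) (f₀ : Vel d → ℝ) (r : ℝ) (W : ℝ → ℝ) (e : Side) :
    EndDensity d :=
  transport f₀ r W (fPlus K f₀ r W e)

/-- `f₊` and `f₋` are related by the law of reflection. -/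
theorem fPlus_eq_reflect {d : ℕ} (K : Vel d → Vel d → ℝ) (f₀ : Vel d → ℝ) (r : ℝ) (W : ℝ → ℝ)
    (e : Side) : fPlus K f₀ r W e = reflect K W e (fMinus K f₀ r W e) :=
  ((reflectTransport K f₀ r W e).map_lfp).symm

/-- `ℓ(u - 𝐢 W(t)) {f₋(t, x, u) - f₀(u)}`. -/
def forceIntegrand {d : ℕ} (K : Vel d → Vel d → ℝ) (f₀ : Vel d → ℝ) (r : ℝ) (W : ℝ → ℝ)
    (e : Side) (t : ℝ) (y : Perp d) (u : Vel d) : ℝ :=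
  ell K (u - horiz d (W t)) * ((fMinus K f₀ r W e t y u).toReal - f₀ u)

/-- The precollision force `R_W(t)`. -/
def precollisionForce {d : ℕ} (K : Vel d → Vel d → ℝ) (f₀ : Vel d → ℝ) (r : ℝ) (W : ℝ → ℝ)
    (t : ℝ) : ℝ :=
  (∫ y in Metric.closedBall (0 : Perp d) r, ∫ u in Side.left.incoming d (W t),
      -forceIntegrand K f₀ r W Side.left t y u)
    + ∫ y in Metric.closedBall (0 : Perp d) r, ∫ u in Side.right.incoming d (W t),
        forceIntegrand K f₀ r W Side.right t y u

/-- `max` of `F'` on `[Vinf - γ, Vinf + γ]`. -/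
def maxSlope (F : ℝ → ℝ) (Vinf γ : ℝ) : ℝ := sSup (deriv F '' Icc (Vinf - γ) (Vinf + γ))

/-- `min` of `F'` on `[Vinf - γ, Vinf + γ]`. -/
def minSlope (F : ℝ → ℝ) (Vinf γ : ℝ) : ℝ := sInf (deriv F '' Icc (Vinf - γ) (Vinf + γ))

/-- The indicator `χ{s ≤ t}`. -/
def chi (s t : ℝ) : ℝ := if s ≤ t then 1 else 0

/-- The class of possible motions for the reversal case, `q` being `p + d`,
`B₀ = max F₀'`, `Binf = min F₀'` and `t₀ = K₀ |ln γ|`. -/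
structure ReversalClass (F₀ : ℝ → ℝ) (p q Vinf γ K₀ Aplus Aminus : ℝ) (W : ℝ → ℝ) : Prop where
  lipschitz : ∃ L, LipschitzOnWith L W (Ici 0)
  initial : W 0 = Vinf + γ
  K₀_lower : 1 / maxSlope F₀ Vinf γ ≤ K₀
  K₀_upper : K₀ ≤ 2 / maxSlope F₀ Vinf γ
  decreasing : AntitoneOn W (Icc 0 (K₀ * |Real.log γ|))
  lower : ∀ t, 0 ≤ t →
    Vinf + γ * (Real.exp (-maxSlope F₀ Vinf γ * t) - γ ^ p * Aplus / (1 + t) ^ q) ≤ W t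
  upper : ∀ t, 0 ≤ t →
    W t ≤ Vinf + γ * (Real.exp (-minSlope F₀ Vinf γ * t)
      - γ ^ p * Aminus / t ^ q * chi (K₀ * |Real.log γ| + 1) t)

end

/-!
A particle contributes to the precollision force at time `t` only if it has hit the same end of the
body before, say at time `s`. Then its horizontal velocity `u_x` is the average of `W` over
`[s, t]`, and the weight `ℓ` is comparable with `|u_x - W(t)|^p`. The whole proof
consists in locating these averages relative to `W(t)`.

**Densities.** The density `f₊` is a least fixed point. It is the limit of the iterates starting
from `0` (`fPlus_eq_iSup_iterate`), hence measurable, since the time of the last precollision is a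
measurable function (`measurable_lastPrecollision`). A supersolution of the law of reflection bounds
it from above (`fPlus_le_of_layer`): if `W` stays within `η` of `Vinf`, then precollided velocities
form a layer of thickness `O(η)`, so up to an error `O(η)` the density of the particles that leave
an end is the one caused by first collisions. Near the velocity `Vinf` this is at most a
multiple of `b` (`GasAssumptions.exists_fPlus_le`), and on the left end, by the Reversal Criterion and dominated
convergence, it is strictly smaller than `f₀` (`GasAssumptions.exists_fPlus_left_le`). So the left
end contributes a positive amount to the force
(`GasAssumptions.exists_forceIntegrand_bounds`); no information on the sign is available on the
right end, nor is it needed.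

**Geometry.** If `s ≤ t / 2`, the transversal velocity is `O(1 / t)`, which gives the volume factor
`t^{-(d-1)}`, and the average of `W - Vinf` is `O(γ / t)`; if `s > t / 2`, the average is
`O(γ / t^{p+d})` (`ReversingMotion.precollision_localization`). Either way the force is
`O(γ^{p+1} / t^{p+d})`, which is the upper bound.

For `t < t₀`, `W` is decreasing, so that no average lies below `W(t)` and the right end contributes
nothing. For `t ≥ t₀`, the average over `[0, t]` exceeds `W(t)` by at least a multiple of `γ / t`,
because the initial exponential has been integrated while `W(t)` itself has dropped
(`ReversingMotion.exists_gap`); all values in between are averages over some `[s, t]`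
(`precollisionTimes_nonempty`), and the left end contributes at least a multiple of
`γ^{p+1} / t^{p+d}`. On the right end only averages below `W(t)` matter; they differ from `W(t)` by
`o(γ) / t`, and the contribution is of smaller order (`ReversingMotion.exists_layers_right`).

The rates are under control because `F₀'(Vinf) > 0` (`GasAssumptions.deriv_freeForce_pos`), so that
`B₀` and `B_∞` tend to this slope as `γ → 0` while `t₀` tends to infinity. As `γ` may be taken small
depending on `A₊`, the correction with `A₊^{p+1}` in the lower bound is itself at most the leading
term.
-/

noncomputable section

/-! ### Precollision times -/

/-- The displacement `∫_0^t W` of the body, with `W` frozen at `W 0` for negative times so that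
only the values of `W` at nonnegative times matter. -/
def displacement (W : ℝ → ℝ) (t : ℝ) : ℝ := ∫ σ in (0 : ℝ)..t, W (max σ 0)

theorem continuous_comp_max_zero {W : ℝ → ℝ} (hW : ContinuousOn W (Ici 0)) :
    Continuous fun σ : ℝ => W (max σ 0) :=
  hW.comp_continuous (by fun_prop) fun _ => mem_Ici.2 (le_max_right _ _)

theorem continuous_displacement {W : ℝ → ℝ} (hW : ContinuousOn W (Ici 0)) :
    Continuous (displacement W) :=
  intervalIntegral.continuous_primitive
    (fun _ _ => (continuous_comp_max_zero hW).intervalIntegrable _ _) 0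

theorem intervalIntegral_eq_displacement_sub {W : ℝ → ℝ} (hW : ContinuousOn W (Ici 0)) {s t : ℝ}
    (hs : 0 ≤ s) (ht : 0 ≤ t) : ∫ σ in s..t, W σ = displacement W t - displacement W s := by
  have hi := fun a b => (continuous_comp_max_zero hW).intervalIntegrable (μ := volume) a b
  rw [displacement, displacement, intervalIntegral.integral_interval_sub_left (hi _ _) (hi _ _)]
  refine intervalIntegral.integral_congr fun σ hσ => ?_
  have : 0 ≤ σ := (le_min hs ht).trans hσ.1
  simp [max_eq_left this]

theorem precollisionTimes_eq_empty {d : ℕ} {r : ℝ} {W : ℝ → ℝ} {t : ℝ} (ht : t ≤ 0) (y : Perp d)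
    (u : Vel d) : precollisionTimes r W t y u = ∅ := by
  ext s
  simp only [precollisionTimes, mem_ofPred_eq, mem_empty_iff_false, iff_false]
  rintro ⟨⟨h1, h2⟩, -⟩
  linarith

theorem bddAbove_precollisionTimes {d : ℕ} (r : ℝ) (W : ℝ → ℝ) (t : ℝ) (y : Perp d) (u : Vel d) :
    BddAbove (precollisionTimes r W t y u) :=
  ⟨t, fun _ hs => hs.1.2.le⟩

theorem lastPrecollision_pos {d : ℕ} {r : ℝ} {W : ℝ → ℝ} {t : ℝ} {y : Perp d} {u : Vel d}
    (h : (precollisionTimes r W t y u).Nonempty) : 0 < lastPrecollision r W t y u := by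
  obtain ⟨s, hs⟩ := h
  exact hs.1.1.trans_le (le_csSup (bddAbove_precollisionTimes r W t y u) hs)

theorem IsSigmaCompact.measurableSet {X : Type*} [TopologicalSpace X] [T2Space X]
    [MeasurableSpace X] [OpensMeasurableSpace X] {s : Set X} (hs : IsSigmaCompact s) :
    MeasurableSet s := by
  obtain ⟨K, hK, rfl⟩ := hs
  exact MeasurableSet.iUnion fun n => (hK n).measurableSet

/-- The set is the projection of a locally closed, hence `σ`-compact, set. -/
theorem measurableSet_exists_precollision_gt {d : ℕ} (r : ℝ) {W : ℝ → ℝ}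
    (hW : ContinuousOn W (Ici 0)) (c : ℝ) :
    MeasurableSet {z : ℝ × Perp d × Vel d |
      ∃ s ∈ precollisionTimes r W z.1 z.2.1 z.2.2, c < s} := by
  let A : Set (ℝ × ℝ × Perp d × Vel d) :=
    {x | 0 < x.1 ∧ x.1 < x.2.1 ∧ c < x.1} ∩
      {x | displacement W x.2.1 - displacement W x.1 = (x.2.1 - x.1) * x.2.2.2.1 ∧
        ‖x.2.2.1 - (x.2.1 - x.1) • x.2.2.2.2‖ ≤ r}
  have hcont := continuous_displacement hW
  have hopen : IsOpen {x : ℝ × ℝ × Perp d × Vel d | 0 < x.1 ∧ x.1 < x.2.1 ∧ c < x.1} := by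
    refine IsOpen.and ?_ (IsOpen.and ?_ ?_) <;> exact isOpen_lt (by fun_prop) (by fun_prop)
  have hclosed : IsClosed {x : ℝ × ℝ × Perp d × Vel d |
      displacement W x.2.1 - displacement W x.1 = (x.2.1 - x.1) * x.2.2.2.1 ∧
        ‖x.2.2.1 - (x.2.1 - x.1) • x.2.2.2.2‖ ≤ r} := by
    rw [ofPred_and]
    refine IsClosed.inter ?_ ?_
    · exact isClosed_eq (by fun_prop) (by fun_prop)
    · exact isClosed_le (by fun_prop) (by fun_prop)
  have hA : IsSigmaCompact A := by
    rw [isSigmaCompact_iff_sigmaCompactSpace]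
    have : LocallyCompactSpace A :=
      (hopen.isLocallyClosed.inter hclosed.isLocallyClosed).locallyCompactSpace
    infer_instance
  convert (hA.image continuous_snd).measurableSet using 1
  ext ⟨t, y, u⟩
  constructor
  · rintro ⟨s, ⟨⟨h1, h2⟩, h3, h4⟩, h5⟩
    rw [intervalIntegral_eq_displacement_sub hW h1.le (h1.trans h2).le] at h3
    exact ⟨(s, t, y, u), ⟨⟨h1, h2, h5⟩, h3, h4⟩, rfl⟩
  · rintro ⟨⟨s, t', y', u'⟩, ⟨⟨h1, h2, h5⟩, h3, h4⟩, h⟩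
    obtain ⟨rfl, rfl, rfl⟩ := h
    dsimp only at h1 h2 h3 h4 h5
    rw [← intervalIntegral_eq_displacement_sub hW h1.le (h1.trans h2).le] at h3
    exact ⟨s, ⟨⟨h1, h2⟩, h3, h4⟩, h5⟩

theorem measurableSet_nonempty_precollision {d : ℕ} (r : ℝ) {W : ℝ → ℝ}
    (hW : ContinuousOn W (Ici 0)) :
    MeasurableSet {z : ℝ × Perp d × Vel d |
      (precollisionTimes r W z.1 z.2.1 z.2.2).Nonempty} := by
  convert measurableSet_exists_precollision_gt (d := d) r hW 0 using 3 with z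
  exact ⟨fun ⟨s, hs⟩ => ⟨s, hs, hs.1.1⟩, fun ⟨s, hs, _⟩ => ⟨s, hs⟩⟩

theorem measurable_lastPrecollision {d : ℕ} (r : ℝ) {W : ℝ → ℝ} (hW : ContinuousOn W (Ici 0)) :
    Measurable fun z : ℝ × Perp d × Vel d => lastPrecollision r W z.1 z.2.1 z.2.2 := by
  refine measurable_of_Ioi fun c => ?_
  have hN := measurableSet_nonempty_precollision (d := d) r hW
  convert (measurableSet_exists_precollision_gt (d := d) r hW c).union
    (hN.compl.inter (MeasurableSet.const (0 > c))) using 1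
  ext z
  simp only [mem_preimage, mem_Ioi, mem_union, mem_ofPred_eq, mem_inter_iff, mem_compl_iff,
    lastPrecollision]
  by_cases h : (precollisionTimes r W z.1 z.2.1 z.2.2).Nonempty
  · rw [lt_csSup_iff (bddAbove_precollisionTimes _ _ _ _ _) h]
    simp [h]
  · rw [not_nonempty_iff_eq_empty] at h
    simp [h, Real.sSup_empty]

/-- Precollision times accumulate at `t` only if `u_x = W(t)`. -/
theorem lastPrecollision_lt {d : ℕ} {r : ℝ} {W : ℝ → ℝ} (hW : ContinuousOn W (Ici 0)) {t : ℝ}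
    {y : Perp d} {u : Vel d} (h : (precollisionTimes r W t y u).Nonempty) (hu : u.1 ≠ W t) :
    lastPrecollision r W t y u < t := by
  have ht : 0 < t := by
    obtain ⟨s, hs⟩ := h
    exact hs.1.1.trans hs.1.2
  refine lt_of_le_of_ne (csSup_le h fun s hs => hs.1.2.le) fun heq => hu ?_
  have hWc := continuous_comp_max_zero hW
  have hder : HasDerivAt (displacement W) (W t) t := by
    have := intervalIntegral.integral_hasDerivAt_right (hWc.intervalIntegrable 0 t)
      hWc.stronglyMeasurable.stronglyMeasurableAtFilter hWc.continuousAt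
    rwa [max_eq_left ht.le] at this
  have hfr : ∃ᶠ s in nhdsWithin t {t}ᶜ, slope (displacement W) t s = u.1 := by
    have hne : ∀ ε > 0, ∃ s ∈ precollisionTimes r W t y u, t - ε < s := fun ε hε =>
      exists_lt_of_lt_csSup h (by rw [lastPrecollision] at heq; linarith)
    rw [(Metric.nhdsWithin_basis_ball (α := ℝ)).frequently_iff]
    intro ε hε
    obtain ⟨s, hs, hs'⟩ := hne ε hε
    have h2 := hs.1.2
    refine ⟨s, ⟨?_, fun h => h2.ne h⟩, ?_⟩
    · rw [Metric.mem_ball, Real.dist_eq, abs_lt]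
      constructor <;> linarith
    · have h3 := hs.2.1
      rw [intervalIntegral_eq_displacement_sub hW hs.1.1.le ht.le] at h3
      rw [slope_def_field, div_eq_iff (by linarith)]
      linarith
  have := (hasDerivAt_iff_tendsto_slope.1 hder)
  exact ((isClosed_singleton (x := u.1)).mem_of_frequently_of_tendsto
    (by simpa using hfr) this).symm

/-! ### Measurability of the densities -/

/-- Joint measurability of a density at positive times. -/
def MeasurableAtPosTimes {d : ℕ} (f : EndDensity d) : Prop :=
  Measurable fun z : ℝ × Perp d × Vel d => if 0 < z.1 then f z.1 z.2.1 z.2.2 else 0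

theorem MeasurableAtPosTimes.transport {d : ℕ} {f₀ : Vel d → ℝ} (hf₀ : Measurable f₀) (r : ℝ)
    {W : ℝ → ℝ} (hW : ContinuousOn W (Ici 0)) {fp : EndDensity d}
    (hfp : MeasurableAtPosTimes fp) : MeasurableAtPosTimes (transport f₀ r W fp) := by
  classical
  have hτ := measurable_lastPrecollision (d := d) r hW
  have hset : MeasurableSet {z : ℝ × Perp d × Vel d |
      (precollisionTimes r W z.1 z.2.1 z.2.2).Nonempty ∧
        lastPrecollision r W z.1 z.2.1 z.2.2 < z.1} :=
    (measurableSet_nonempty_precollision r hW).inter (measurableSet_lt hτ measurable_fst)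
  have hmap : Measurable fun z : ℝ × Perp d × Vel d =>
      ((lastPrecollision r W z.1 z.2.1 z.2.2,
        z.2.1 - (z.1 - lastPrecollision r W z.1 z.2.1 z.2.2) • z.2.2.2, z.2.2) :
        ℝ × Perp d × Vel d) := by
    fun_prop
  refine Measurable.ite (measurableSet_lt measurable_const measurable_fst) ?_ measurable_const
  have := @Measurable.ite _ _ _ _ _ _ _ (Classical.decPred _) hset (hfp.comp hmap)
    (ENNReal.measurable_ofReal.comp (hf₀.comp (measurable_snd.comp measurable_snd)))
  convert this using 2 with z
  unfold _root_.transport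
  split_ifs with h
  · simp only [Function.comp, lastPrecollision_pos h.1, if_true]
  · rfl

theorem measurableSet_incoming {d : ℕ} (V : ℝ) (e : Side) : MeasurableSet (e.incoming d V) := by
  cases e
  · exact measurableSet_le measurable_const measurable_fst
  · exact measurableSet_le measurable_fst measurable_const

theorem MeasurableAtPosTimes.reflect {d : ℕ} {K : Vel d → Vel d → ℝ}
    (hK : Measurable (Function.uncurry K)) {W : ℝ → ℝ} (hW : ContinuousOn W (Ici 0)) (e : Side)
    {fm : EndDensity d} (hfm : MeasurableAtPosTimes fm) :
    MeasurableAtPosTimes (reflect K W e fm) := by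
  have hWm := (continuous_comp_max_zero hW).measurable
  let g : (ℝ × Perp d × Vel d) × Vel d → ℝ≥0∞ := fun x =>
    indicator {x : (ℝ × Perp d × Vel d) × Vel d | x.2 ∈ e.incoming d (W (max x.1.1 0))}
      (fun x => ENNReal.ofReal (K (x.1.2.2 - horiz d (W (max x.1.1 0)))
          (x.2 - horiz d (W (max x.1.1 0)))) *
        (if 0 < x.1.1 then fm x.1.1 x.1.2.1 x.2 else 0)) x
  have hset : MeasurableSet {x : (ℝ × Perp d × Vel d) × Vel d |
      x.2 ∈ e.incoming d (W (max x.1.1 0))} := by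
    have h1 : Measurable fun x : (ℝ × Perp d × Vel d) × Vel d => W (max x.1.1 0) :=
      hWm.comp (measurable_fst.comp measurable_fst)
    cases e
    · exact measurableSet_le h1 (by fun_prop)
    · exact measurableSet_le (by fun_prop) h1
  have hg : Measurable g := by
    refine Measurable.indicator (Measurable.mul ?_ ?_) hset
    · refine ENNReal.measurable_ofReal.comp (hK.comp (f := fun x : (ℝ × Perp d × Vel d) × Vel d =>
        (x.1.2.2 - horiz d (W (max x.1.1 0)), x.2 - horiz d (W (max x.1.1 0)))) ?_)
      have h1 : Measurable fun x : (ℝ × Perp d × Vel d) × Vel d => W (max x.1.1 0) :=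
        hWm.comp (measurable_fst.comp measurable_fst)
      have h2 : Measurable fun x : (ℝ × Perp d × Vel d) × Vel d => horiz d (W (max x.1.1 0)) :=
        h1.prodMk measurable_const
      exact ((measurable_snd.comp (measurable_snd.comp measurable_fst)).sub h2).prodMk
        (measurable_snd.sub h2)
    · exact hfm.comp (g := fun z : ℝ × Perp d × Vel d =>
        if 0 < z.1 then fm z.1 z.2.1 z.2.2 else 0)
        (f := fun x : (ℝ × Perp d × Vel d) × Vel d => (x.1.1, x.1.2.1, x.2)) (by fun_prop)
  have := hg.lintegral_prod_right' (ν := volume)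
  have hm := this.indicator (measurableSet_lt measurable_const measurable_fst : MeasurableSet
      {z : ℝ × Perp d × Vel d | 0 < z.1})
  unfold MeasurableAtPosTimes
  convert hm using 2 with z
  by_cases hz : 0 < z.1
  · rw [indicator_of_mem (by exact hz)]
    simp only [hz, if_true, _root_.reflect, g]
    rw [← lintegral_indicator (measurableSet_incoming _ e)]
    refine lintegral_congr fun u => ?_
    have hmax : max z.1 0 = z.1 := max_eq_left hz.le
    by_cases hu : u ∈ e.incoming d (W z.1)
    · rw [indicator_of_mem hu, indicator_of_mem (by simpa only [mem_ofPred_eq, hmax] using hu)]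
      simp only [hmax, hz, if_true]
    · rw [indicator_of_notMem hu,
        indicator_of_notMem (by simpa only [mem_ofPred_eq, hmax] using hu)]
  · rw [indicator_of_notMem (by exact hz), if_neg hz]

theorem MeasurableAtPosTimes.section_measurable {d : ℕ} {f : EndDensity d}
    (hf : MeasurableAtPosTimes f) {t : ℝ} (ht : 0 < t) :
    Measurable fun z : Perp d × Vel d => f t z.1 z.2 := by
  have := hf.comp (f := fun z : Perp d × Vel d => (t, z.1, z.2)) (by fun_prop)
  simpa [Function.comp_def, ht] using this

theorem transport_of_nonpos {d : ℕ} (f₀ : Vel d → ℝ) (r : ℝ) (W : ℝ → ℝ) (fp : EndDensity d)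
    {t : ℝ} (ht : t ≤ 0) (y : Perp d) (u : Vel d) :
    transport f₀ r W fp t y u = ENNReal.ofReal (f₀ u) := by
  simp [transport, precollisionTimes_eq_empty ht]

section Iteration

variable {d : ℕ} {K : Vel d → Vel d → ℝ} {f₀ : Vel d → ℝ} {r : ℝ} {W : ℝ → ℝ} {e : Side}

theorem MeasurableAtPosTimes.iterate (hK : Measurable (Function.uncurry K)) (hf₀ : Measurable f₀)
    (hW : ContinuousOn W (Ici 0)) (n : ℕ) :
    MeasurableAtPosTimes ((reflectTransport K f₀ r W e)^[n] ⊥) := by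
  induction n with
  | zero =>
    simp [MeasurableAtPosTimes]
  | succ n ih =>
    rw [Function.iterate_succ_apply']
    exact (ih.transport hf₀ r hW).reflect hK hW e

/-- Kleene iteration: by monotone convergence, the least solution of the law of reflection is the
limit of the iterates that start from `0`. -/
theorem fPlus_eq_iSup_iterate (hK : Measurable (Function.uncurry K)) (hf₀ : Measurable f₀)
    (hW : ContinuousOn W (Ici 0)) :
    fPlus K f₀ r W e = ⨆ n : ℕ, (reflectTransport K f₀ r W e)^[n] ⊥ := by
  set Φ := reflectTransport K f₀ r W e with hΦ
  have hmono : Monotone fun n : ℕ => Φ^[n] ⊥ := Φ.monotone.monotone_iterate_of_le_map bot_le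
  refine le_antisymm ?_ (iSup_le fun n => ?_)
  · refine OrderHom.lfp_le _ fun t y v => ?_
    rcases le_or_gt t 0 with ht | ht
    · -- at nonpositive times one step already gives the solution
      have : Φ (⨆ n : ℕ, Φ^[n] ⊥) t y v = Φ^[1] ⊥ t y v := by
        have h0 : ∀ fp, Φ fp t y v = reflect K W e (transport f₀ r W fp) t y v := fun _ => rfl
        simp only [Function.iterate_one, h0, reflect, transport_of_nonpos _ _ _ _ ht]
      change Φ _ t y v ≤ _
      rw [this]
      exact le_iSup (fun n : ℕ => Φ^[n] ⊥) 1 t y v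
    · have htr : ∀ u, transport f₀ r W (⨆ n : ℕ, Φ^[n] ⊥) t y u =
          ⨆ n : ℕ, transport f₀ r W (Φ^[n] ⊥) t y u := by
        intro u
        unfold transport
        split_ifs
        · simp only [iSup_apply]
        · simp
      have htm : ∀ n : ℕ, Monotone fun g : EndDensity d => transport f₀ r W g t y := by
        intro n f g hfg u
        simp only [transport]
        split_ifs
        · exact hfg _ _ _
        · exact le_rfl
      have key : Φ (⨆ n : ℕ, Φ^[n] ⊥) t y v = ⨆ n : ℕ, Φ^[n + 1] ⊥ t y v := by
        simp only [Function.iterate_succ_apply']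
        change reflect K W e (transport f₀ r W (⨆ n : ℕ, Φ^[n] ⊥)) t y v
          = ⨆ n : ℕ, reflect K W e (transport f₀ r W (Φ^[n] ⊥)) t y v
        unfold reflect
        simp_rw [htr, ENNReal.mul_iSup]
        rw [lintegral_iSup]
        · intro n
          refine Measurable.mul (ENNReal.measurable_ofReal.comp (hK.comp
            (f := fun u => (v - horiz d (W t), u - horiz d (W t))) (by fun_prop))) ?_
          have h1 := ((MeasurableAtPosTimes.iterate (r := r) (e := e) hK hf₀ hW n).transport
            hf₀ r hW).section_measurable ht
          exact h1.comp (f := fun u => (y, u)) (by fun_prop)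
        · intro m n hmn u
          exact mul_le_mul_right (htm 0 (hmono hmn) u) _
      change Φ _ t y v ≤ _
      rw [key]
      simp only [iSup_apply]
      exact iSup_le fun n => le_iSup (fun n : ℕ => Φ^[n] ⊥ t y v) (n + 1)
  · induction n with
    | zero => exact bot_le
    | succ n ih =>
      rw [Function.iterate_succ_apply']
      exact (Φ.monotone ih).trans_eq Φ.map_lfp

theorem measurableAtPosTimes_fPlus (hK : Measurable (Function.uncurry K)) (hf₀ : Measurable f₀)
    (hW : ContinuousOn W (Ici 0)) : MeasurableAtPosTimes (fPlus K f₀ r W e) := by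
  rw [fPlus_eq_iSup_iterate hK hf₀ hW]
  unfold MeasurableAtPosTimes
  convert Measurable.iSup fun n : ℕ =>
    MeasurableAtPosTimes.iterate (r := r) (e := e) hK hf₀ hW n using 2 with z
  split_ifs <;> simp [iSup_apply]

theorem measurableAtPosTimes_fMinus (hK : Measurable (Function.uncurry K)) (hf₀ : Measurable f₀)
    (hW : ContinuousOn W (Ici 0)) : MeasurableAtPosTimes (fMinus K f₀ r W e) :=
  (measurableAtPosTimes_fPlus hK hf₀ hW).transport hf₀ r hW

end Iteration

/-! ### The collision kernel -/

/-- `ℓ(w)` as a function of the horizontal component of `w`, see `GasAssumptions.ell_eq`. -/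
def longitudinalMoment (k : ℝ → ℝ → ℝ) (w : ℝ) : ℝ := w ^ 2 + secondMoment k w

/-- The horizontal components of the velocities in `Side.incoming`. -/
def Side.halfLine (V : ℝ) : Side → Set ℝ
  | Side.left => Ici V
  | Side.right => Iic V

theorem Side.incoming_eq_prod {d : ℕ} (e : Side) (V : ℝ) :
    e.incoming d V = e.halfLine V ×ˢ (univ : Set (Perp d)) := by
  cases e <;> ext u <;> simp [Side.incoming, Side.halfLine]

section Gas

variable {d : ℕ} {k : ℝ → ℝ → ℝ} {a₀ : ℝ → ℝ} {b : Perp d → ℝ} {p Vinf γ₀ : ℝ}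

namespace GasAssumptions

theorem integrable_b (h : GasAssumptions k a₀ b p Vinf γ₀) : Integrable b := by
  by_contra hb
  have := h.b_integral
  rw [integral_undef hb] at this
  norm_num at this

theorem lintegral_b (h : GasAssumptions k a₀ b p Vinf γ₀) :
    ∫⁻ y, ENNReal.ofReal (b y) = 1 := by
  rw [← ofReal_integral_eq_lintegral_ofReal h.integrable_b (ae_of_all _ h.b_nonneg),
    h.b_integral, ENNReal.ofReal_one]

theorem ell_eq (h : GasAssumptions k a₀ b p Vinf γ₀) (w : Vel d) :
    ell (collisionKernel k b) w = longitudinalMoment k w.1 := by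
  have hset : {v : Vel d | 0 ≤ v.1} = Ici (0 : ℝ) ×ˢ (univ : Set (Perp d)) := by
    ext v
    simp
  rw [ell, longitudinalMoment, secondMoment, hset]
  congr 1
  have := setIntegral_prod_mul (μ := (volume : Measure ℝ)) (ν := (volume : Measure (Perp d)))
    (fun v : ℝ => v ^ 2 * k v w.1) b (Ici 0) univ
  rw [setIntegral_univ, h.b_integral, mul_one] at this
  rw [← this, Measure.volume_eq_prod]
  simp only [collisionKernel, mul_assoc]

theorem measurable_longitudinalMoment (h : GasAssumptions k a₀ b p Vinf γ₀) :
    Measurable (longitudinalMoment k) := by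
  have hk := h.k_continuous
  have : StronglyMeasurable fun u => ∫ v in Ici (0 : ℝ), v ^ 2 * k v u := by
    refine StronglyMeasurable.integral_prod_right (f := fun u v : ℝ => v ^ 2 * k v u) ?_
    refine Continuous.stronglyMeasurable ?_
    have : Continuous fun x : ℝ × ℝ => k x.2 x.1 := hk.comp (f := fun x : ℝ × ℝ => (x.2, x.1))
      (by fun_prop)
    unfold Function.uncurry
    fun_prop
  exact (measurable_id.pow_const 2).add this.measurable

theorem measurable_collisionKernel (h : GasAssumptions k a₀ b p Vinf γ₀) :
    Measurable (Function.uncurry (collisionKernel k b)) := by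
  have h1 : Continuous fun x : Vel d × Vel d => k x.1.1 x.2.1 :=
    h.k_continuous.comp (f := fun x : Vel d × Vel d => (x.1.1, x.2.1)) (by fun_prop)
  have h2 : Continuous fun x : Vel d × Vel d => b x.1.2 := h.b_continuous.comp (by fun_prop)
  exact (h1.mul h2).measurable

theorem measurable_initialDensity (h : GasAssumptions k a₀ b p Vinf γ₀) :
    Measurable (initialDensity a₀ b : Vel d → ℝ) :=
  ((h.a₀_continuous.comp continuous_fst).mul (h.b_continuous.comp continuous_snd)).measurable

theorem secondMoment_nonneg (h : GasAssumptions k a₀ b p Vinf γ₀) (u : ℝ) :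
    0 ≤ secondMoment k u :=
  setIntegral_nonneg measurableSet_Ici fun v _ => mul_nonneg (sq_nonneg v) (h.k_nonneg v u)

theorem longitudinalMoment_nonneg (h : GasAssumptions k a₀ b p Vinf γ₀) (u : ℝ) :
    0 ≤ longitudinalMoment k u :=
  add_nonneg (sq_nonneg u) (h.secondMoment_nonneg u)

theorem secondMoment_even (h : GasAssumptions k a₀ b p Vinf γ₀) (u : ℝ) :
    secondMoment k (-u) = secondMoment k u := by
  simp only [secondMoment, h.k_even_right]

theorem secondMoment_zero (h : GasAssumptions k a₀ b p Vinf γ₀) (hγ₀ : 0 < γ₀) :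
    secondMoment k 0 = 0 := by
  obtain ⟨c, C, -, -, hm⟩ := h.power_law
  have := (hm 0 (by simpa using hγ₀.le)).2
  rw [abs_zero, Real.zero_rpow h.p_pos.ne', mul_zero] at this
  exact this.antisymm (h.secondMoment_nonneg 0)

theorem longitudinalMoment_zero (h : GasAssumptions k a₀ b p Vinf γ₀) (hγ₀ : 0 < γ₀) :
    longitudinalMoment k 0 = 0 := by
  simp [longitudinalMoment, h.secondMoment_zero hγ₀]

/-- Near `0` the quadratic part of `ℓ` is dominated by the power law, because `p ≤ 2`. -/
theorem exists_longitudinalMoment_bounds (h : GasAssumptions k a₀ b p Vinf γ₀) :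
    ∃ c C : ℝ, 0 < c ∧ 0 < C ∧ ∀ u, |u| ≤ γ₀ → |u| ≤ 1 →
      c * |u| ^ p ≤ longitudinalMoment k u ∧ longitudinalMoment k u ≤ C * |u| ^ p := by
  obtain ⟨c, C, hc, hC, hm⟩ := h.power_law
  refine ⟨c, C + 1, hc, by linarith, fun u hu hu1 => ?_⟩
  obtain ⟨h1, h2⟩ := hm u hu
  have h3 : u ^ 2 ≤ |u| ^ p := by
    have := Real.rpow_le_rpow_of_exponent_ge_of_imp (abs_nonneg u) hu1 h.p_le_two
      fun _ h0 => absurd h0 two_ne_zero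
    rwa [Real.rpow_two, sq_abs] at this
  unfold longitudinalMoment
  constructor
  · nlinarith [sq_nonneg u]
  · linarith

end GasAssumptions

/-! ### A priori bounds for the densities after collision -/

/-- The horizontal factor of the density, at the velocity `v`, of the particles which leave the
given end of a body moving with velocity `V` after their first collision. -/
def freshReflection (k : ℝ → ℝ → ℝ) (a₀ : ℝ → ℝ) (e : Side) (v V : ℝ) : ℝ≥0∞ :=
  ∫⁻ z in e.halfLine V, ENNReal.ofReal (k (v - V) (z - V) * a₀ z)

/-- If particles which have collided before are present only in a thin layer of velocities, then
the reflected density consists of a part due to first collisions and of a part proportional to the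
thickness of the layer. -/
theorem reflect_le (h : GasAssumptions k a₀ b p Vinf γ₀) {η G Mk : ℝ} (hG : 0 ≤ G)
    (hMk : 0 ≤ Mk) (W : ℝ → ℝ) (e : Side) (fm : EndDensity d) (t : ℝ) (y : Perp d) (v : Vel d)
    (hk : ∀ z, |z - Vinf| ≤ η → k (v.1 - W t) (z - W t) ≤ Mk)
    (hfm : ∀ u : Vel d, fm t y u ≤ ENNReal.ofReal (initialDensity a₀ b u) +
      indicator {u : Vel d | |u.1 - Vinf| ≤ η} (fun u => ENNReal.ofReal (G * b u.2)) u) :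
    reflect (collisionKernel k b) W e fm t y v ≤ ENNReal.ofReal (b v.2) *
      (freshReflection k a₀ e v.1 (W t) + ENNReal.ofReal (2 * η * Mk * G)) := by
  have hbm : Measurable fun y => ENNReal.ofReal (b y) :=
    ENNReal.measurable_ofReal.comp h.b_continuous.measurable
  have hkm : Measurable fun z => ENNReal.ofReal (k (v.1 - W t) (z - W t)) := by
    refine ENNReal.measurable_ofReal.comp (Continuous.measurable ?_)
    exact h.k_continuous.comp (f := fun z : ℝ => (v.1 - W t, z - W t)) (by fun_prop)
  have hkam : Measurable fun z => ENNReal.ofReal (k (v.1 - W t) (z - W t) * a₀ z) := by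
    simp_rw [ENNReal.ofReal_mul (h.k_nonneg _ _)]
    exact hkm.mul (ENNReal.measurable_ofReal.comp h.a₀_continuous.measurable)
  let J : Set ℝ := Icc (Vinf - η) (Vinf + η)
  have hJ : ∀ z, z ∈ J ↔ |z - Vinf| ≤ η := fun z => by
    rw [abs_le, mem_Icc]
    constructor <;> rintro ⟨h1, h2⟩ <;> constructor <;> linarith
  have hprod : ∀ g : ℝ → ℝ≥0∞, Measurable g →
      ∫⁻ u in e.incoming d (W t), g u.1 * ENNReal.ofReal (b u.2) =
        ∫⁻ z in e.halfLine (W t), g z := by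
    intro g hg
    rw [e.incoming_eq_prod, Measure.volume_eq_prod, ← Measure.prod_restrict,
      lintegral_prod_mul hg.aemeasurable (hbm.aemeasurable), Measure.restrict_univ, h.lintegral_b,
      mul_one]
  calc reflect (collisionKernel k b) W e fm t y v
      ≤ ∫⁻ u in e.incoming d (W t), ENNReal.ofReal (b v.2) *
          ((ENNReal.ofReal (k (v.1 - W t) (u.1 - W t) * a₀ u.1) +
            J.indicator (fun _ => ENNReal.ofReal (Mk * G)) u.1) * ENNReal.ofReal (b u.2)) := by
        refine lintegral_mono fun u => ?_
        refine (mul_le_mul_right (hfm u) _).trans ?_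
        have e1 : collisionKernel k b (v - horiz d (W t)) (u - horiz d (W t)) =
            b v.2 * k (v.1 - W t) (u.1 - W t) := by
          simp [collisionKernel, horiz, mul_comm]
        have hkn := h.k_nonneg (v.1 - W t) (u.1 - W t)
        rw [e1, ENNReal.ofReal_mul (h.b_nonneg _), mul_assoc]
        refine mul_le_mul_right ?_ _
        rw [mul_add, add_mul]
        refine add_le_add ?_ ?_
        · rw [initialDensity, ← ENNReal.ofReal_mul hkn,
            ← ENNReal.ofReal_mul (mul_nonneg hkn (h.a₀_nonneg _)), mul_assoc]
        · by_cases hu : |u.1 - Vinf| ≤ η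
          · rw [indicator_of_mem (by exact hu), indicator_of_mem ((hJ _).2 hu),
              ← ENNReal.ofReal_mul hkn, ← ENNReal.ofReal_mul (mul_nonneg hMk hG)]
            refine ENNReal.ofReal_le_ofReal ?_
            have := mul_le_mul_of_nonneg_right (hk _ hu) (mul_nonneg hG (h.b_nonneg u.2))
            linarith
          · rw [indicator_of_notMem (by exact hu)]
            simp
    _ = ENNReal.ofReal (b v.2) * ∫⁻ z in e.halfLine (W t),
          (ENNReal.ofReal (k (v.1 - W t) (z - W t) * a₀ z) +
            J.indicator (fun _ => ENNReal.ofReal (Mk * G)) z) := by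
        have hm : Measurable fun z => (ENNReal.ofReal (k (v.1 - W t) (z - W t) * a₀ z) +
            J.indicator (fun _ => ENNReal.ofReal (Mk * G)) z) :=
          hkam.add (measurable_const.indicator measurableSet_Icc)
        rw [lintegral_const_mul _ (by
          exact (hm.comp measurable_fst).mul (hbm.comp measurable_snd)), hprod _ hm]
    _ ≤ _ := by
        refine mul_le_mul_right ?_ _
        rw [lintegral_add_left hkam]
        refine add_le_add le_rfl ?_
        refine (setLIntegral_le_lintegral _ _).trans ?_
        rw [lintegral_indicator measurableSet_Icc, setLIntegral_const, Real.volume_Icc,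
          ← ENNReal.ofReal_mul (mul_nonneg hMk hG)]
        refine ENNReal.ofReal_le_ofReal (le_of_eq (by ring))

/-- The horizontal velocity of a particle with a precollision is an average of the velocity of the
body. -/
theorem abs_sub_le_of_precollision {r : ℝ} {W : ℝ → ℝ} (hW : ContinuousOn W (Ici 0)) {η V t : ℝ}
    (hη : ∀ s, 0 ≤ s → |W s - V| ≤ η) {y : Perp d} {u : Vel d}
    (hu : (precollisionTimes r W t y u).Nonempty) : |u.1 - V| ≤ η := by
  obtain ⟨s, ⟨hs0, hst⟩, hs, -⟩ := hu
  have hi : IntervalIntegrable W volume s t :=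
    (hW.mono (by rw [uIcc_of_le hst.le]; exact fun x hx => hs0.le.trans hx.1)).intervalIntegrable
  have h1 : ∫ σ in s..t, (W σ - V) = (t - s) * (u.1 - V) := by
    rw [intervalIntegral.integral_sub hi intervalIntegrable_const, hs]
    simp
    ring
  have h2 := intervalIntegral.norm_integral_le_of_norm_le_const (a := s) (b := t)
    (f := fun σ => W σ - V) (C := η) (fun x hx => by
      rw [uIoc_of_le hst.le] at hx
      exact hη x (hs0.trans hx.1).le)
  have h3 : 0 < t - s := sub_pos.2 hst
  rw [h1, Real.norm_eq_abs, abs_mul, abs_of_pos h3, mul_comm] at h2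
  exact le_of_mul_le_mul_right h2 h3

theorem GasAssumptions.exists_freshReflection_le (h : GasAssumptions k a₀ b p Vinf γ₀) :
    ∃ M : ℝ, 0 ≤ M ∧ ∀ (e : Side) (v V : ℝ), |v - V| < 2 * γ₀ → |V - Vinf| < γ₀ →
      freshReflection k a₀ e v V ≤ ENNReal.ofReal M := by
  obtain ⟨M, hM, hle⟩ := h.domination
  refine ⟨∫ z, ‖M z‖, by positivity, fun e v V hv hV => ?_⟩
  refine (setLIntegral_le_lintegral _ _).trans ?_
  rw [ofReal_integral_eq_lintegral_ofReal hM.norm (ae_of_all _ fun z => norm_nonneg _)]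
  refine lintegral_mono fun z => ENNReal.ofReal_le_ofReal ?_
  have := hle (v - V) (V - Vinf) z hv hV
  rw [show z - (V - Vinf) - Vinf = z - V by ring] at this
  exact this.trans (le_abs_self _)

/-- A bound valid for the velocities of precollided particles is reproduced by the law of
reflection, hence holds for the least solution. -/
theorem fPlus_le_of_layer {r : ℝ} (h : GasAssumptions k a₀ b p Vinf γ₀) {η G Mk : ℝ}
    (hG : 0 ≤ G) (hMk : 0 ≤ Mk) {W : ℝ → ℝ} (hW : ContinuousOn W (Ici 0))
    (hWη : ∀ t, 0 ≤ t → |W t - Vinf| ≤ η) (hk : ∀ v u, |u| ≤ 2 * η → k v u ≤ Mk)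
    (e : Side) {B : ℝ → ℝ} (hB : ∀ v, |v - Vinf| ≤ η → B v ≤ G)
    (hfresh : ∀ v V, |v - Vinf| ≤ η → |V - Vinf| ≤ η →
      freshReflection k a₀ e v V + ENNReal.ofReal (2 * η * Mk * G) ≤ ENNReal.ofReal (B v))
    {t : ℝ} (ht : 0 < t) (y : Perp d) {v : Vel d} (hv : |v.1 - Vinf| ≤ η) :
    fPlus (collisionKernel k b) (initialDensity a₀ b) r W e t y v
      ≤ ENNReal.ofReal (B v.1 * b v.2) := by
  classical
  let g : EndDensity d := fun t _ v =>
    if 0 < t ∧ |v.1 - Vinf| ≤ η then ENNReal.ofReal (B v.1 * b v.2) else ⊤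
  suffices hle : fPlus (collisionKernel k b) (initialDensity a₀ b) r W e ≤ g by
    have := hle t y v
    rwa [show g t y v = _ from if_pos ⟨ht, hv⟩] at this
  refine OrderHom.lfp_le _ fun t y v => ?_
  by_cases htv : 0 < t ∧ |v.1 - Vinf| ≤ η
  · obtain ⟨ht, hv⟩ := htv
    rw [show g t y v = _ from if_pos ⟨ht, hv⟩]
    refine (reflect_le (η := η) h hG hMk W e (transport (initialDensity a₀ b) r W g) t y v
      (fun z hz => hk _ _ ?_) fun u => ?_).trans ?_
    · have h1 := hWη t ht.le
      rw [abs_le] at *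
      constructor <;> linarith
    · unfold transport
      split_ifs with hu
      · have hu1 := abs_sub_le_of_precollision hW hWη hu.1
        rw [indicator_of_mem (by exact hu1),
          show g _ (y - (t - lastPrecollision r W t y u) • u.2) u = _ from
            if_pos ⟨lastPrecollision_pos hu.1, hu1⟩]
        exact le_add_left (ENNReal.ofReal_le_ofReal
          (mul_le_mul_of_nonneg_right (hB _ hu1) (h.b_nonneg _)))
      · exact le_self_add
    · rw [mul_comm (B v.1), ENNReal.ofReal_mul (h.b_nonneg _)]
      exact mul_le_mul_right (hfresh _ _ hv (hWη t ht.le)) _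
  · rw [show g t y v = _ from if_neg htv]
    exact le_top

/-- A particle which leaves either end with a velocity near `Vinf` has density at most a multiple
of `b`. -/
theorem GasAssumptions.exists_fPlus_le (h : GasAssumptions k a₀ b p Vinf γ₀) (hγ₀ : 0 < γ₀) :
    ∃ G η₀ : ℝ, 0 < G ∧ 0 < η₀ ∧ ∀ (r η : ℝ) (W : ℝ → ℝ), η ≤ η₀ → ContinuousOn W (Ici 0) →
      (∀ t, 0 ≤ t → |W t - Vinf| ≤ η) → ∀ (e : Side) (t : ℝ) (y : Perp d) (v : Vel d), 0 < t →
        |v.1 - Vinf| ≤ η → fPlus (collisionKernel k b) (initialDensity a₀ b) r W e t y v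
          ≤ ENNReal.ofReal (G * b v.2) := by
  obtain ⟨M, hM0, hM⟩ := h.exists_freshReflection_le
  obtain ⟨Mk, hMk⟩ := h.bounded
  have hMk0 : 0 ≤ Mk := (h.k_nonneg 0 0).trans (hMk 0 0 (by simpa using hγ₀.le))
  refine ⟨2 * M + 1, min (γ₀ / 2) (1 / (4 * (Mk + 1))), by linarith, by positivity, ?_⟩
  intro r η W hη hW hWη e t y v ht hv
  have hη0 : 0 ≤ η := (abs_nonneg _).trans hv
  have h1 : η ≤ γ₀ / 2 := hη.trans (min_le_left _ _)
  have h2 : 2 * η * Mk ≤ 1 / 2 := by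
    have := hη.trans (min_le_right _ _)
    rw [le_div_iff₀ (by positivity)] at this
    nlinarith
  refine fPlus_le_of_layer h (B := fun _ => 2 * M + 1) (by linarith) hMk0 hW hWη
    (fun v u hu => hMk v u (by linarith)) e (fun _ _ => le_rfl) ?_ ht y hv
  intro v V hv hV
  refine (add_le_add (hM e v V ?_ (by linarith)) le_rfl).trans ?_
  · rw [abs_le] at hv hV
    rw [abs_lt]
    constructor <;> linarith
  · rw [← ENNReal.ofReal_add hM0 (by positivity)]
    refine ENNReal.ofReal_le_ofReal ?_
    nlinarith

theorem GasAssumptions.tendsto_freshReflection_left (h : GasAssumptions k a₀ b p Vinf γ₀)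
    (hγ₀ : 0 < γ₀) :
    Filter.Tendsto (fun x : ℝ × ℝ => freshReflection k a₀ Side.left x.1 x.2) (nhds (Vinf, Vinf))
      (nhds (ENNReal.ofReal (∫ z in Ioi (0 : ℝ), k 0 z * a₀ (z + Vinf)))) := by
  obtain ⟨M, hM, hle⟩ := h.domination
  have hkc : Continuous fun x : ℝ × ℝ => k x.1 x.2 := h.k_continuous
  have hac := h.a₀_continuous
  have hlim : ∫⁻ z, (Ici Vinf).indicator (fun z => ENNReal.ofReal (k 0 (z - Vinf) * a₀ z)) z =
      ENNReal.ofReal (∫ z in Ioi (0 : ℝ), k 0 z * a₀ (z + Vinf)) := by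
    have hint : Integrable fun z => k 0 z * a₀ (z + Vinf) := by
      refine (hM.comp_add_right Vinf).mono' ?_ (ae_of_all _ fun z => ?_)
      · exact ((hkc.comp (f := fun z : ℝ => ((0 : ℝ), z)) (by fun_prop)).mul
          (hac.comp (by fun_prop))).aestronglyMeasurable
      · rw [Real.norm_of_nonneg (mul_nonneg (h.k_nonneg _ _) (h.a₀_nonneg _))]
        have := hle 0 0 (z + Vinf) (by simpa using hγ₀) (by simpa using hγ₀)
        simpa using this
    rw [ofReal_integral_eq_lintegral_ofReal hint.integrableOn
      (ae_of_all _ fun z => mul_nonneg (h.k_nonneg _ _) (h.a₀_nonneg _)),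
      setLIntegral_congr Ioi_ae_eq_Ici, ← lintegral_indicator measurableSet_Ici,
      ← lintegral_add_right_eq_self _ Vinf]
    refine lintegral_congr fun z => ?_
    simp only [indicator, mem_Ici, le_add_iff_nonneg_left, add_sub_cancel_right]
  rw [← hlim]
  simp only [freshReflection, Side.halfLine, ← lintegral_indicator measurableSet_Ici]
  refine tendsto_lintegral_filter_of_dominated_convergence
    (fun z => ENNReal.ofReal (M z)) ?_ ?_ ?_ ?_
  · refine Filter.Eventually.of_forall fun x => ?_
    refine (ENNReal.measurable_ofReal.comp (Continuous.measurable ?_)).indicator measurableSet_Ici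
    exact (hkc.comp (f := fun z : ℝ => (x.1 - x.2, z - x.2)) (by fun_prop)).mul hac
  · have e1 : ∀ᶠ x : ℝ × ℝ in nhds (Vinf, Vinf), |x.1 - x.2| < 2 * γ₀ :=
      ContinuousAt.eventually_lt (by fun_prop) continuousAt_const (by simpa using hγ₀)
    have e2 : ∀ᶠ x : ℝ × ℝ in nhds (Vinf, Vinf), |x.2 - Vinf| < γ₀ :=
      ContinuousAt.eventually_lt (by fun_prop) continuousAt_const (by simpa using hγ₀)
    filter_upwards [e1, e2] with x h1 h2
    refine ae_of_all _ fun z => ?_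
    refine (indicator_le_self' (fun _ _ => zero_le) z).trans (ENNReal.ofReal_le_ofReal ?_)
    have := hle (x.1 - x.2) (x.2 - Vinf) z h1 h2
    rwa [show z - (x.2 - Vinf) - Vinf = z - x.2 by ring] at this
  · exact hM.lintegral_lt_top.ne
  · filter_upwards [compl_mem_ae_iff.2 (measure_singleton Vinf)] with z hz
    have hz' : z ≠ Vinf := hz
    have hcont : Filter.Tendsto
        (fun x : ℝ × ℝ => ENNReal.ofReal (k (x.1 - x.2) (z - x.2) * a₀ z)) (nhds (Vinf, Vinf))
        (nhds (ENNReal.ofReal (k 0 (z - Vinf) * a₀ z))) := by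
      have : Continuous fun x : ℝ × ℝ => ENNReal.ofReal (k (x.1 - x.2) (z - x.2) * a₀ z) :=
        ENNReal.continuous_ofReal.comp ((hkc.comp (f := fun x : ℝ × ℝ => (x.1 - x.2, z - x.2))
          (by fun_prop)).mul continuous_const)
      simpa using this.tendsto (Vinf, Vinf)
    rcases lt_or_gt_of_ne hz' with hlt | hgt
    · have e1 : ∀ᶠ x : ℝ × ℝ in nhds (Vinf, Vinf), z < x.2 :=
        continuousAt_snd.eventually_const_lt hlt
      rw [indicator_of_notMem (by simpa using hlt)]
      refine tendsto_const_nhds.congr' ?_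
      filter_upwards [e1] with x hx
      rw [indicator_of_notMem (by simpa using hx)]
    · have e1 : ∀ᶠ x : ℝ × ℝ in nhds (Vinf, Vinf), x.2 < z :=
        continuousAt_snd.eventually_lt_const hgt
      rw [indicator_of_mem (by simpa using hgt.le)]
      refine hcont.congr' ?_
      filter_upwards [e1] with x hx
      rw [indicator_of_mem (by simpa using hx.le)]

/-- By the Reversal Criterion, the left end emits particles with velocities near `Vinf` at a
density strictly below the initial one. -/
theorem GasAssumptions.exists_fPlus_left_le (h : GasAssumptions k a₀ b p Vinf γ₀) (hγ₀ : 0 < γ₀)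
    (hrev : ReversalCriterion k a₀ Vinf) :
    ∃ δ η₀ : ℝ, 0 < δ ∧ 0 < η₀ ∧ ∀ (r η : ℝ) (W : ℝ → ℝ), η ≤ η₀ → ContinuousOn W (Ici 0) →
      (∀ t, 0 ≤ t → |W t - Vinf| ≤ η) → ∀ (t : ℝ) (y : Perp d) (v : Vel d), 0 < t →
        |v.1 - Vinf| ≤ η → δ ≤ a₀ v.1 ∧
          fPlus (collisionKernel k b) (initialDensity a₀ b) r W Side.left t y v
            ≤ ENNReal.ofReal ((a₀ v.1 - δ) * b v.2) := by
  obtain ⟨Mk, hMk⟩ := h.bounded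
  have hMk0 : 0 ≤ Mk := (h.k_nonneg 0 0).trans (hMk 0 0 (by simpa using hγ₀.le))
  set I := ∫ z in Ioi (0 : ℝ), k 0 z * a₀ (z + Vinf) with hI
  have hI0 : 0 ≤ I := setIntegral_nonneg measurableSet_Ioi fun z _ =>
    mul_nonneg (h.k_nonneg _ _) (h.a₀_nonneg _)
  have hrev' : I < a₀ Vinf := hrev
  -- the gap is split into four equal parts
  set δ := (a₀ Vinf - I) / 4 with hδ
  have hδ0 : 0 < δ := by linarith
  set G := a₀ Vinf + δ with hG
  have ev1 : ∀ᶠ x : ℝ × ℝ in nhds (Vinf, Vinf),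
      freshReflection k a₀ Side.left x.1 x.2 < ENNReal.ofReal (I + δ) :=
    (h.tendsto_freshReflection_left hγ₀).eventually_lt_const
      ((ENNReal.ofReal_lt_ofReal_iff (by linarith)).2 (by linarith))
  obtain ⟨ε₁, hε₁, hball⟩ := Metric.eventually_nhds_iff.1 ev1
  obtain ⟨ε₂, hε₂, hcont⟩ := Metric.continuous_iff.1 h.a₀_continuous Vinf δ hδ0
  refine ⟨δ, min (min (ε₁ / 2) (ε₂ / 2)) (min (γ₀ / 2) (δ / (2 * (Mk + 1) * (G + 1)))), hδ0,
    by have : 0 < G := by linarith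
       positivity, ?_⟩
  intro r η W hη hW hWη t y v ht hv
  have hη0 : 0 ≤ η := (abs_nonneg _).trans hv
  have h1 : η ≤ ε₁ / 2 := hη.trans ((min_le_left _ _).trans (min_le_left _ _))
  have h2 : η ≤ ε₂ / 2 := hη.trans ((min_le_left _ _).trans (min_le_right _ _))
  have h3 : η ≤ γ₀ / 2 := hη.trans ((min_le_right _ _).trans (min_le_left _ _))
  have hG0 : 0 < G := by linarith
  have h4 : 2 * η * Mk * G ≤ δ := by
    have := hη.trans ((min_le_right _ _).trans (min_le_right _ _))
    rw [le_div_iff₀ (by positivity)] at this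
    have h5 : Mk * G ≤ (Mk + 1) * (G + 1) := by nlinarith
    nlinarith [mul_le_mul_of_nonneg_left h5 hη0]
  have ha : ∀ v, |v - Vinf| ≤ η → |a₀ v - a₀ Vinf| < δ := fun v hv =>
    hcont v (by rw [Real.dist_eq]; linarith)
  have ha' : ∀ v, |v - Vinf| ≤ η → a₀ Vinf - δ < a₀ v ∧ a₀ v < a₀ Vinf + δ := fun v hv => by
    have := abs_lt.1 (ha v hv)
    constructor <;> linarith
  refine ⟨by linarith [(ha' _ hv).1], ?_⟩
  refine fPlus_le_of_layer h (B := fun v => a₀ v - δ) (G := G) hG0.le hMk0 hW hWη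
    (fun v u hu => hMk v u (by linarith)) _ (fun v hv => by linarith [(ha' v hv).2]) ?_ ht y hv
  intro v V hv hV
  have hb := hball (y := (v, V)) (by
    rw [Prod.dist_eq, Real.dist_eq, Real.dist_eq]
    exact max_lt (by linarith) (by linarith))
  refine (add_le_add hb.le (ENNReal.ofReal_le_ofReal h4)).trans ?_
  rw [← ENNReal.ofReal_add (by linarith) hδ0.le]
  exact ENNReal.ofReal_le_ofReal (by linarith [(ha' v hv).1])

end Gas

/-! ### The force integrand -/

section Gas

variable {d : ℕ} {k : ℝ → ℝ → ℝ} {a₀ : ℝ → ℝ} {b : Perp d → ℝ} {p Vinf γ₀ : ℝ}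

theorem GasAssumptions.measurable_forceIntegrand (h : GasAssumptions k a₀ b p Vinf γ₀) {r : ℝ}
    {W : ℝ → ℝ} (hW : ContinuousOn W (Ici 0)) (e : Side) {t : ℝ} (ht : 0 < t) :
    Measurable fun z : Perp d × Vel d =>
      forceIntegrand (collisionKernel k b) (initialDensity a₀ b) r W e t z.1 z.2 := by
  unfold forceIntegrand
  simp only [h.ell_eq]
  have h1 : Measurable fun z : Perp d × Vel d =>
      longitudinalMoment k (z.2 - horiz d (W t)).1 :=
    h.measurable_longitudinalMoment.comp
      (measurable_fst.comp (measurable_snd.sub (measurable_const (a := horiz d (W t)))))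
  have h2 := (measurableAtPosTimes_fMinus (r := r) (e := e) h.measurable_collisionKernel
    h.measurable_initialDensity hW).section_measurable ht
  exact h1.mul (h2.ennreal_toReal.sub (h.measurable_initialDensity.comp measurable_snd))

theorem GasAssumptions.initialDensity_nonneg (h : GasAssumptions k a₀ b p Vinf γ₀) (u : Vel d) :
    0 ≤ initialDensity a₀ b u :=
  mul_nonneg (h.a₀_nonneg _) (h.b_nonneg _)

theorem GasAssumptions.forceIntegrand_eq_zero (h : GasAssumptions k a₀ b p Vinf γ₀) {r : ℝ}
    {W : ℝ → ℝ} {e : Side} {t : ℝ} {y : Perp d} {u : Vel d}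
    (hu : ¬((precollisionTimes r W t y u).Nonempty ∧ lastPrecollision r W t y u < t)) :
    forceIntegrand (collisionKernel k b) (initialDensity a₀ b) r W e t y u = 0 := by
  rw [forceIntegrand, fMinus, transport, if_neg hu,
    ENNReal.toReal_ofReal (h.initialDensity_nonneg u), sub_self, mul_zero]

theorem GasAssumptions.forceIntegrand_eq_zero_of_eq (h : GasAssumptions k a₀ b p Vinf γ₀)
    (hγ₀ : 0 < γ₀) {r : ℝ} {W : ℝ → ℝ} {e : Side} {t : ℝ} {y : Perp d} {u : Vel d}
    (hu : u.1 = W t) :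
    forceIntegrand (collisionKernel k b) (initialDensity a₀ b) r W e t y u = 0 := by
  simp [forceIntegrand, h.ell_eq, horiz, hu, h.longitudinalMoment_zero hγ₀]

theorem fMinus_eq_of_precollision {K : Vel d → Vel d → ℝ} {f₀ : Vel d → ℝ} {r : ℝ} {W : ℝ → ℝ}
    {e : Side} {t : ℝ} {y : Perp d} {u : Vel d}
    (hu : (precollisionTimes r W t y u).Nonempty ∧ lastPrecollision r W t y u < t) :
    fMinus K f₀ r W e t y u = fPlus K f₀ r W e (lastPrecollision r W t y u)
      (y - (t - lastPrecollision r W t y u) • u.2) u := by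
  rw [fMinus, transport, if_pos hu]

/-- The integrand of the precollision force is comparable with `|u_x - W(t)|^p b(u_⊥)`; on the left
end it is nonpositive, and strictly negative where there is a precollision. -/
theorem GasAssumptions.exists_forceIntegrand_bounds (h : GasAssumptions k a₀ b p Vinf γ₀)
    (hγ₀ : 0 < γ₀) (hrev : ReversalCriterion k a₀ Vinf) :
    ∃ Cf δ η₀ : ℝ, 0 < Cf ∧ 0 < δ ∧ 0 < η₀ ∧ ∀ (r η : ℝ) (W : ℝ → ℝ), η ≤ η₀ →
      ContinuousOn W (Ici 0) → (∀ t, 0 ≤ t → |W t - Vinf| ≤ η) →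
      ∀ (t : ℝ) (y : Perp d) (u : Vel d), 0 < t →
        (∀ e, |forceIntegrand (collisionKernel k b) (initialDensity a₀ b) r W e t y u|
          ≤ Cf * |u.1 - W t| ^ p * b u.2) ∧
        forceIntegrand (collisionKernel k b) (initialDensity a₀ b) r W Side.left t y u ≤ 0 ∧
        ((precollisionTimes r W t y u).Nonempty → u.1 ≠ W t →
          forceIntegrand (collisionKernel k b) (initialDensity a₀ b) r W Side.left t y u
            ≤ -(δ * |u.1 - W t| ^ p * b u.2)) := by
  obtain ⟨G, η₁, hG, hη₁, hplus⟩ := h.exists_fPlus_le hγ₀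
  obtain ⟨δ, η₂, hδ, hη₂, hleft⟩ := h.exists_fPlus_left_le hγ₀ hrev
  obtain ⟨cL, CL, hcL, hCL, hL⟩ := h.exists_longitudinalMoment_bounds
  obtain ⟨η₃, hη₃, hcont⟩ := Metric.continuous_iff.1 h.a₀_continuous Vinf 1 one_pos
  have ha0 := h.a₀_nonneg Vinf
  refine ⟨CL * (G + (a₀ Vinf + 1)), cL * δ, min (min η₁ η₂) (min (η₃ / 2) (min (1 / 2) (γ₀ / 2))),
    by positivity, by positivity, by positivity, ?_⟩
  intro r η W hη hW hWη t y u ht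
  have l1 : η ≤ η₁ := hη.trans ((min_le_left _ _).trans (min_le_left _ _))
  have l2 : η ≤ η₂ := hη.trans ((min_le_left _ _).trans (min_le_right _ _))
  have l3 : η ≤ η₃ / 2 := hη.trans ((min_le_right _ _).trans (min_le_left _ _))
  have l4 : η ≤ 1 / 2 :=
    hη.trans ((min_le_right _ _).trans ((min_le_right _ _).trans (min_le_left _ _)))
  have l5 : η ≤ γ₀ / 2 :=
    hη.trans ((min_le_right _ _).trans ((min_le_right _ _).trans (min_le_right _ _)))
  have hbu := h.b_nonneg u.2
  have hpw : 0 ≤ |u.1 - W t| ^ p := by positivity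
  by_cases hu : (precollisionTimes r W t y u).Nonempty ∧ lastPrecollision r W t y u < t
  · have hu1 : |u.1 - Vinf| ≤ η := abs_sub_le_of_precollision hW hWη hu.1
    have hτ := lastPrecollision_pos hu.1
    have hdiff : |u.1 - W t| ≤ 2 * η := by
      have h1 := hWη t ht.le
      rw [abs_le] at *
      constructor <;> linarith
    obtain ⟨hL1, hL2⟩ := hL (u.1 - W t) (by linarith) (by linarith)
    have hL0 := h.longitudinalMoment_nonneg (u.1 - W t)
    have ha1 : a₀ u.1 ≤ a₀ Vinf + 1 := by
      have := hcont u.1 (by rw [Real.dist_eq]; linarith)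
      rw [Real.dist_eq, abs_lt] at this
      linarith
    have hf0 : initialDensity a₀ b u ≤ (a₀ Vinf + 1) * b u.2 :=
      mul_le_mul_of_nonneg_right ha1 hbu
    have hf00 := h.initialDensity_nonneg u
    have hform : ∀ e, forceIntegrand (collisionKernel k b) (initialDensity a₀ b) r W e t y u =
        longitudinalMoment k (u.1 - W t) *
          ((fMinus (collisionKernel k b) (initialDensity a₀ b) r W e t y u).toReal
            - initialDensity a₀ b u) := by
      intro e
      rw [forceIntegrand, h.ell_eq]
      rfl
    have hneg : forceIntegrand (collisionKernel k b) (initialDensity a₀ b) r W Side.left t y u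
        ≤ -(cL * δ * |u.1 - W t| ^ p * b u.2) := by
      obtain ⟨hδa, hle⟩ := hleft r η W l2 hW hWη (lastPrecollision r W t y u)
        (y - (t - lastPrecollision r W t y u) • u.2) u hτ hu1
      rw [← fMinus_eq_of_precollision hu] at hle
      have hle' := ENNReal.toReal_le_of_le_ofReal
        (mul_nonneg (sub_nonneg.2 hδa) hbu) hle
      rw [hform]
      have hd : (fMinus (collisionKernel k b) (initialDensity a₀ b) r W Side.left t y u).toReal
            - initialDensity a₀ b u ≤ -(δ * b u.2) := by
        unfold initialDensity at *
        linarith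
      have := mul_le_mul_of_nonneg_left hd hL0
      have h2 := mul_le_mul_of_nonneg_right hL1 (mul_nonneg hδ.le hbu)
      linarith
    refine ⟨fun e => ?_, hneg.trans (neg_nonpos.2 (by positivity)), fun _ _ => hneg⟩
    have hle := hplus r η W l1 hW hWη e (lastPrecollision r W t y u)
      (y - (t - lastPrecollision r W t y u) • u.2) u hτ hu1
    rw [← fMinus_eq_of_precollision hu] at hle
    have hle' := ENNReal.toReal_le_of_le_ofReal (mul_nonneg hG.le hbu) hle
    have h0 := ENNReal.toReal_nonneg
      (a := fMinus (collisionKernel k b) (initialDensity a₀ b) r W e t y u)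
    rw [hform, abs_mul, abs_of_nonneg hL0]
    have hd : |(fMinus (collisionKernel k b) (initialDensity a₀ b) r W e t y u).toReal
            - initialDensity a₀ b u| ≤ (G + (a₀ Vinf + 1)) * b u.2 := by
      rw [abs_le]
      constructor <;> nlinarith
    calc _ ≤ CL * |u.1 - W t| ^ p * ((G + (a₀ Vinf + 1)) * b u.2) :=
          mul_le_mul hL2 hd (abs_nonneg _) (by positivity)
      _ = _ := by ring
  · have hz := fun e => h.forceIntegrand_eq_zero (e := e) hu
    refine ⟨fun e => ?_, (hz _).le, fun h1 h2 => absurd ⟨h1, lastPrecollision_lt hW h1 h2⟩ hu⟩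
    rw [hz, abs_zero]
    positivity

/-! ### Integrals over the precollided velocities -/

theorem volume_closedBall_perp (d : ℕ) {ρ : ℝ} (hρ : 0 ≤ ρ) :
    volume (Metric.closedBall (0 : Perp d) ρ) = ENNReal.ofReal
      (ρ ^ (d - 1) * (volume : Measure (Perp d)).real (Metric.closedBall 0 1)) := by
  rw [Measure.addHaar_closedBall' _ _ hρ, ENNReal.ofReal_mul (by positivity),
    finrank_euclideanSpace, Fintype.card_fin, measureReal_def,
    ENNReal.ofReal_toReal (isCompact_closedBall _ _).measure_lt_top.ne]

theorem mem_Icc_of_abs_sub_le {x V D : ℝ} (h : |x - V| ≤ D) : x ∈ Icc (V - D) (V + D) := by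
  rw [abs_le] at h
  constructor <;> linarith

/-- An integrand comparable with `|u_x - V|^p b(u_⊥)` is integrated over velocities which either
have `u_x` in a layer of thickness `D₁` and `u_⊥` in a ball of radius `ρ`, or have `u_x` in a layer
of thickness `D₂`. -/
theorem GasAssumptions.exists_lintegral_layers_le (h : GasAssumptions k a₀ b p Vinf γ₀) (r R : ℝ)
    (hr : 0 < r) :
    ∃ C : ℝ, 0 < C ∧ ∀ (F : Perp d × Vel d → ℝ) (V D₁ D₂ ρ Cf : ℝ) (S : Set (Vel d)),
      MeasurableSet S → 0 ≤ D₁ → 0 ≤ D₂ → 0 ≤ ρ → ρ ≤ R → 0 ≤ Cf →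
      (∀ y u, ‖y‖ ≤ r → u ∈ S → F (y, u) = 0 ∨ (|F (y, u)| ≤ Cf * |u.1 - V| ^ p * b u.2 ∧
        ((|u.1 - V| ≤ D₁ ∧ ‖u.2‖ ≤ ρ) ∨ |u.1 - V| ≤ D₂))) →
      ∫⁻ z in Metric.closedBall (0 : Perp d) r ×ˢ S, ‖F z‖ₑ
        ≤ ENNReal.ofReal (C * Cf * (D₁ ^ (p + 1) * ρ ^ (d - 1) + D₂ ^ (p + 1))) := by
  obtain ⟨β, hβ⟩ := (isCompact_closedBall (0 : Perp d) R).exists_bound_of_continuousOn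
    h.b_continuous.continuousOn
  set ω := (volume : Measure (Perp d)).real (Metric.closedBall 0 1) with hω
  have hω0 : 0 ≤ ω := measureReal_nonneg
  have hp1 : p + 1 ≠ 0 := by linarith [h.p_pos]
  refine ⟨2 * (r ^ (d - 1) * ω) * (|β| * ω) + 2 * (r ^ (d - 1) * ω) + 1, by positivity, ?_⟩
  intro F V D₁ D₂ ρ Cf S hS hD₁ hD₂ hρ hρR hCf hF
  have hbm : Measurable fun y => ENNReal.ofReal (b y) :=
    ENNReal.measurable_ofReal.comp h.b_continuous.measurable
  let T₁ : Set (Perp d × Vel d) := Metric.closedBall (0 : Perp d) r ×ˢ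
    (Icc (V - D₁) (V + D₁) ×ˢ Metric.closedBall (0 : Perp d) ρ)
  let T₂ : Set (Perp d × Vel d) := Metric.closedBall (0 : Perp d) r ×ˢ
    (Icc (V - D₂) (V + D₂) ×ˢ (univ : Set (Perp d)))
  have hT₁ : MeasurableSet T₁ := measurableSet_closedBall.prod
    (measurableSet_Icc.prod measurableSet_closedBall)
  have hT₂ : MeasurableSet T₂ := measurableSet_closedBall.prod
    (measurableSet_Icc.prod MeasurableSet.univ)
  let A : ℝ≥0∞ := ENNReal.ofReal (Cf * D₁ ^ p * |β|)
  let B : ℝ≥0∞ := ENNReal.ofReal (Cf * D₂ ^ p)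
  calc ∫⁻ z in Metric.closedBall (0 : Perp d) r ×ˢ S, ‖F z‖ₑ
      ≤ ∫⁻ z in Metric.closedBall (0 : Perp d) r ×ˢ S,
          (T₁.indicator (fun _ => A) z
            + T₂.indicator (fun z => B * ENNReal.ofReal (b z.2.2)) z) := by
        refine setLIntegral_mono' (measurableSet_closedBall.prod hS) ?_
        rintro ⟨y, u⟩ ⟨hy, hu⟩
        have hy' : ‖y‖ ≤ r := mem_closedBall_zero_iff.1 hy
        rcases hF y u hy' hu with h0 | ⟨hle, hlay⟩
        · simp [h0]
        · rw [← ofReal_norm, Real.norm_eq_abs]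
          rcases hlay with ⟨h1, h2⟩ | h1
          · have hmem : (y, u) ∈ T₁ :=
              ⟨hy, mem_Icc_of_abs_sub_le h1, mem_closedBall_zero_iff.2 h2⟩
            rw [indicator_of_mem hmem]
            refine le_add_right (ENNReal.ofReal_le_ofReal (hle.trans ?_))
            have hb : b u.2 ≤ |β| := (le_abs_self _).trans ((hβ u.2
              (mem_closedBall_zero_iff.2 (h2.trans hρR))).trans (le_abs_self _))
            have hpw := Real.rpow_le_rpow (abs_nonneg _) h1 h.p_pos.le
            have := h.b_nonneg u.2
            gcongr
          · have hmem : (y, u) ∈ T₂ := ⟨hy, mem_Icc_of_abs_sub_le h1, mem_univ _⟩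
            rw [indicator_of_mem hmem, ← ENNReal.ofReal_mul (by positivity)]
            refine le_add_left (ENNReal.ofReal_le_ofReal (hle.trans ?_))
            have hpw := Real.rpow_le_rpow (abs_nonneg _) h1 h.p_pos.le
            have := h.b_nonneg u.2
            gcongr
    _ ≤ ∫⁻ z, (T₁.indicator (fun _ => A) z
            + T₂.indicator (fun z => B * ENNReal.ofReal (b z.2.2)) z) :=
        setLIntegral_le_lintegral _ _
    _ = A * volume T₁ + ∫⁻ z in T₂, B * ENNReal.ofReal (b z.2.2) := by
        rw [lintegral_add_left (measurable_const.indicator hT₁), lintegral_indicator hT₁,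
          setLIntegral_const, lintegral_indicator hT₂]
    _ = ENNReal.ofReal (2 * (r ^ (d - 1) * ω) * (|β| * ω) * Cf * (D₁ ^ (p + 1) * ρ ^ (d - 1))
          + 2 * (r ^ (d - 1) * ω) * Cf * D₂ ^ (p + 1)) := by
        have e1 : volume T₁ = ENNReal.ofReal
            (r ^ (d - 1) * ω * ((2 * D₁) * (ρ ^ (d - 1) * ω))) := by
          simp only [T₁, Measure.volume_eq_prod, Measure.prod_prod, Real.volume_Icc]
          rw [volume_closedBall_perp d hr.le, volume_closedBall_perp d hρ,
            ← ENNReal.ofReal_mul (by linarith), ← ENNReal.ofReal_mul (by positivity)]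
          congr 2
          ring
        have e2 : ∫⁻ z in T₂, B * ENNReal.ofReal (b z.2.2)
            = ENNReal.ofReal (Cf * D₂ ^ p * (r ^ (d - 1) * ω * (2 * D₂))) := by
          have hm : Measurable fun u : Vel d => B * ENNReal.ofReal (b u.2) :=
            (hbm.comp measurable_snd).const_mul _
          have hm' : Measurable fun z : Perp d × Vel d => B * ENNReal.ofReal (b z.2.2) :=
            hm.comp measurable_snd
          simp only [T₂]
          rw [Measure.volume_eq_prod, ← Measure.prod_restrict,
            lintegral_prod _ hm'.aemeasurable]
          dsimp only
          rw [lintegral_const, Measure.volume_eq_prod, ← Measure.prod_restrict,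
            lintegral_prod _ hm.aemeasurable]
          dsimp only
          rw [lintegral_const, Measure.restrict_univ,
            lintegral_const_mul _ hbm, h.lintegral_b, Measure.restrict_apply_univ,
            Measure.restrict_apply_univ, Real.volume_Icc, volume_closedBall_perp d hr.le, mul_one,
            ← ENNReal.ofReal_mul (by positivity), ← ENNReal.ofReal_mul
              (mul_nonneg (by positivity) (by linarith))]
          congr 1
          ring
        rw [e1, e2, ← ENNReal.ofReal_mul (by positivity), ← ENNReal.ofReal_add (by positivity)
          (by positivity), Real.rpow_add_one' hD₁ hp1, Real.rpow_add_one' hD₂ hp1]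
        congr 1
        ring
    _ ≤ _ := by
        refine ENNReal.ofReal_le_ofReal ?_
        have h1 : 0 ≤ D₁ ^ (p + 1) * ρ ^ (d - 1) := by positivity
        have h2 : 0 ≤ D₂ ^ (p + 1) := by positivity
        have h3 : 0 ≤ 2 * (r ^ (d - 1) * ω) * (|β| * ω) := by positivity
        have h4 : 0 ≤ 2 * (r ^ (d - 1) * ω) := by positivity
        nlinarith [mul_nonneg (mul_nonneg h3 hCf) h2, mul_nonneg (mul_nonneg h4 hCf) h1,
          mul_nonneg hCf h1, mul_nonneg hCf h2]

/-- A lower bound for the contribution of a layer of velocities of thickness `Δ` in the direction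
of motion and of width `1 / t` in the transversal directions. -/
theorem GasAssumptions.exists_le_setIntegral_layer (h : GasAssumptions k a₀ b p Vinf γ₀) {r : ℝ}
    (hr : 0 < r) :
    ∃ c ρ : ℝ, 0 < c ∧ 0 < ρ ∧ ρ ≤ r / 2 ∧ ∀ (F : Perp d × Vel d → ℝ) (V Δ t δ : ℝ),
      0 ≤ Δ → 1 ≤ t → 0 ≤ δ →
      IntegrableOn F (Metric.closedBall (0 : Perp d) r ×ˢ Side.left.incoming d V) →
      (∀ z, F z ≤ 0) →
      (∀ y u, ‖y‖ ≤ r / 2 → V + Δ / 2 ≤ u.1 → u.1 < V + Δ → ‖u.2‖ ≤ ρ / t →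
        F (y, u) ≤ -(δ * |u.1 - V| ^ p * b u.2)) →
      c * δ * Δ ^ (p + 1) / t ^ (d - 1)
        ≤ ∫ z in Metric.closedBall (0 : Perp d) r ×ˢ Side.left.incoming d V, -F z := by
  have hb0 := h.b_zero
  obtain ⟨ρ₀, hρ₀, hb⟩ := Metric.continuous_iff.1 h.b_continuous 0 (b 0 / 2) (by linarith)
  set ω := (volume : Measure (Perp d)).real (Metric.closedBall 0 1) with hω
  have hωpos : 0 < ω :=
    ENNReal.toReal_pos (Metric.measure_closedBall_pos _ _ one_pos).ne'
      (isCompact_closedBall _ _).measure_lt_top.ne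
  set ρ := min (ρ₀ / 2) (r / 2) with hρ
  have hρpos : 0 < ρ := by positivity
  have hp1 : p + 1 ≠ 0 := by linarith [h.p_pos]
  refine ⟨(1 / 2) ^ p * (b 0 / 2) * ((r / 2) ^ (d - 1) * ω * (1 / 2 * (ρ ^ (d - 1) * ω))), ρ,
    by positivity, hρpos, min_le_right _ _, ?_⟩
  intro F V Δ t δ hΔ ht hδ hint hF0 hF
  have ht0 : 0 < t := by linarith
  let T : Set (Perp d × Vel d) := Metric.closedBall (0 : Perp d) (r / 2) ×ˢ
    (Ico (V + Δ / 2) (V + Δ) ×ˢ Metric.closedBall (0 : Perp d) (ρ / t))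
  have hT : MeasurableSet T := measurableSet_closedBall.prod
    (measurableSet_Ico.prod measurableSet_closedBall)
  have hTS : T ⊆ Metric.closedBall (0 : Perp d) r ×ˢ Side.left.incoming d V := by
    rintro ⟨y, u⟩ ⟨hy, hu1, -⟩
    refine ⟨Metric.closedBall_subset_closedBall (by linarith) hy, ?_⟩
    have := hu1.1
    change V ≤ u.1
    dsimp only at this
    linarith
  have e1 : volume T = ENNReal.ofReal
      ((r / 2) ^ (d - 1) * ω * ((Δ / 2) * ((ρ / t) ^ (d - 1) * ω))) := by
    simp only [T, Measure.volume_eq_prod, Measure.prod_prod, Real.volume_Ico]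
    rw [volume_closedBall_perp d (by positivity), volume_closedBall_perp d (by positivity),
      ← ENNReal.ofReal_mul (by linarith), ← ENNReal.ofReal_mul (by positivity)]
    congr 2
    ring
  have hconst : ∀ z ∈ T, δ * (Δ / 2) ^ p * (b 0 / 2) ≤ -F z := by
    rintro ⟨y, u⟩ ⟨hy, hu1, hu2⟩
    have hu2' : ‖u.2‖ ≤ ρ / t := mem_closedBall_zero_iff.1 hu2
    have h1 := hF y u (mem_closedBall_zero_iff.1 hy) hu1.1 hu1.2 hu2'
    have h2 : Δ / 2 ≤ |u.1 - V| := by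
      have := hu1.1
      dsimp only at this
      exact le_trans (by linarith) (le_abs_self _)
    have h3 : b 0 / 2 ≤ b u.2 := by
      have hlt : dist u.2 0 < ρ₀ := by
        rw [dist_zero_right]
        have : ρ / t ≤ ρ := div_le_self hρpos.le ht
        have := min_le_left (ρ₀ / 2) (r / 2)
        linarith
      have := hb u.2 hlt
      rw [Real.dist_eq, abs_lt] at this
      linarith
    have h4 := Real.rpow_le_rpow (by positivity) h2 h.p_pos.le
    refine le_trans ?_ (le_neg.2 h1)
    gcongr
  have hge := setIntegral_ge_of_const_le_real hT (by rw [e1]; exact ENNReal.ofReal_ne_top) hconst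
    (hint.neg.mono_set hTS)
  have hmono := setIntegral_mono_set hint.neg (ae_of_all _ fun z => neg_nonneg.2 (hF0 z))
    (Filter.Eventually.of_forall hTS : T ≤ᵐ[volume] _)
  refine le_trans (le_of_eq ?_) (hge.trans hmono)
  rw [measureReal_def, e1, ENNReal.toReal_ofReal (by positivity), Real.rpow_add_one' hΔ hp1,
    div_eq_mul_one_div Δ 2, Real.mul_rpow hΔ (by norm_num), div_pow ρ t]
  field_simp

end Gas

/-! ### Averages of the velocity of the body -/

theorem integral_exp_neg_mul {β : ℝ} (hβ : β ≠ 0) (s t : ℝ) :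
    ∫ σ in s..t, Real.exp (-β * σ) = (Real.exp (-β * s) - Real.exp (-β * t)) / β := by
  have hd : ∀ σ ∈ uIcc s t,
      HasDerivAt (fun σ => -(Real.exp (-β * σ) / β)) (Real.exp (-β * σ)) σ := by
    intro σ _
    have := ((((hasDerivAt_id σ).const_mul (-β)).exp).div_const β).neg
    refine HasDerivAt.congr_deriv this ?_
    simp only [id, mul_one]
    field_simp
  rw [intervalIntegral.integral_eq_sub_of_hasDerivAt hd
    (Continuous.intervalIntegrable (by fun_prop) _ _)]
  ring

theorem continuousOn_one_div_one_add_rpow (q : ℝ) :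
    ContinuousOn (fun σ : ℝ => 1 / (1 + σ) ^ q) (Ici 0) := by
  intro σ hσ
  have : 0 < 1 + σ := by
    have : (0 : ℝ) ≤ σ := hσ
    linarith
  refine ContinuousAt.continuousWithinAt (ContinuousAt.div continuousAt_const ?_
    (Real.rpow_pos_of_pos this q).ne')
  exact (continuousAt_const.add continuousAt_id).rpow_const (Or.inl this.ne')

theorem integral_one_div_one_add_rpow_le {q : ℝ} (hq : 1 < q) {s t : ℝ} (hs : 0 ≤ s)
    (hst : s ≤ t) : ∫ σ in s..t, 1 / (1 + σ) ^ q ≤ 1 / (q - 1) := by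
  have hq' : 0 < q - 1 := by linarith
  have hmem : ∀ σ ∈ uIcc s t, 0 ≤ σ := fun σ hσ => by
    rw [uIcc_of_le hst] at hσ
    exact hs.trans hσ.1
  have hd : ∀ σ ∈ uIcc s t,
      HasDerivAt (fun σ => -((1 + σ) ^ (1 - q) / (q - 1))) (1 / (1 + σ) ^ q) σ := by
    intro σ hσ
    have hpos : 0 < 1 + σ := by linarith [hmem σ hσ]
    have := (((((hasDerivAt_id σ).const_add 1).rpow_const (p := 1 - q) (Or.inl hpos.ne')).div_const
      (q - 1))).neg
    refine HasDerivAt.congr_deriv this ?_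
    simp only [id, show 1 - q - 1 = -q by ring, Real.rpow_neg hpos.le]
    field_simp
    ring
  rw [intervalIntegral.integral_eq_sub_of_hasDerivAt hd
    (((continuousOn_one_div_one_add_rpow q).mono fun σ hσ => hmem σ hσ).intervalIntegrable)]
  have h1 : (1 + s) ^ (1 - q) ≤ 1 :=
    Real.rpow_le_one_of_one_le_of_nonpos (by linarith) (by linarith)
  have h2 : 0 ≤ (1 + t) ^ (1 - q) := Real.rpow_nonneg (by linarith) _
  rw [neg_sub_neg, ← sub_div]
  exact div_le_div_of_nonneg_right (by linarith) hq'.le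

/-- The properties of the motions of the reversal class on which the estimates rest: relative to
`γ`, the excess velocity `W - Vinf` lies between two exponentials, up to an error `θ / (1 + t)^q`
from below, and `W` decreases on the initial interval `[0, t₀]`. -/
structure ReversingMotion (B β q Vinf γ θ t₀ : ℝ) (W : ℝ → ℝ) : Prop where
  continuousOn : ContinuousOn W (Ici 0)
  lower : ∀ t, 0 ≤ t → Vinf + γ * (Real.exp (-B * t) - θ / (1 + t) ^ q) ≤ W t
  upper : ∀ t, 0 ≤ t → W t ≤ Vinf + γ * Real.exp (-β * t)
  decreasing : AntitoneOn W (Icc 0 t₀)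

namespace ReversingMotion

variable {B β q Vinf γ θ t₀ : ℝ} {W : ℝ → ℝ}

theorem lower' (h : ReversingMotion B β q Vinf γ θ t₀ W) (hγ : 0 ≤ γ) {t : ℝ} (ht : 0 ≤ t) :
    Vinf - γ * (θ / (1 + t) ^ q) ≤ W t := by
  have h1 := h.lower t ht
  have h2 : 0 ≤ γ * Real.exp (-B * t) := by positivity
  linarith

theorem abs_sub_le (h : ReversingMotion B β q Vinf γ θ t₀ W) (hγ : 0 ≤ γ) (hβ : 0 ≤ β)
    (hq : 0 ≤ q) (hθ : 0 ≤ θ) (hθ1 : θ ≤ 1) {t : ℝ} (ht : 0 ≤ t) : |W t - Vinf| ≤ γ := by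
  have h1 := h.lower' hγ ht
  have h2 := h.upper t ht
  have h3 : θ / (1 + t) ^ q ≤ 1 := by
    have : 1 ≤ (1 + t) ^ q := Real.one_le_rpow (by linarith) hq
    exact (div_le_self hθ this).trans hθ1
  have h4 : Real.exp (-β * t) ≤ 1 := Real.exp_le_one_iff.2 (by nlinarith)
  have h5 := mul_le_mul_of_nonneg_left h3 hγ
  have h6 := mul_le_mul_of_nonneg_left h4 hγ
  rw [abs_le]
  constructor <;> linarith

theorem intervalIntegrable (h : ReversingMotion B β q Vinf γ θ t₀ W) {s t : ℝ} (hs : 0 ≤ s)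
    (hst : s ≤ t) : IntervalIntegrable W volume s t :=
  (h.continuousOn.mono (by rw [uIcc_of_le hst]; exact fun x hx => hs.trans hx.1)).intervalIntegrable

theorem integral_le (h : ReversingMotion B β q Vinf γ θ t₀ W) (hγ : 0 ≤ γ) (hβ : 0 < β) {s t : ℝ}
    (hs : 0 ≤ s) (hst : s ≤ t) : ∫ σ in s..t, W σ ≤ (t - s) * Vinf + γ / β := by
  calc ∫ σ in s..t, W σ ≤ ∫ σ in s..t, (Vinf + γ * Real.exp (-β * σ)) :=
        intervalIntegral.integral_mono_on hst (h.intervalIntegrable hs hst)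
          (Continuous.intervalIntegrable (by fun_prop) _ _)
          fun σ hσ => h.upper σ (hs.trans hσ.1)
    _ = (t - s) * Vinf + γ * ((Real.exp (-β * s) - Real.exp (-β * t)) / β) := by
        rw [intervalIntegral.integral_add intervalIntegrable_const
          (Continuous.intervalIntegrable (by fun_prop) _ _),
          intervalIntegral.integral_const_mul, integral_exp_neg_mul hβ.ne']
        simp
    _ ≤ _ := by
        have h1 : Real.exp (-β * s) ≤ 1 := Real.exp_le_one_iff.2 (by nlinarith)
        have h2 := Real.exp_pos (-β * t)
        have : (Real.exp (-β * s) - Real.exp (-β * t)) / β ≤ 1 / β :=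
          div_le_div_of_nonneg_right (by linarith) hβ.le
        have := mul_le_mul_of_nonneg_left this hγ
        rw [mul_one_div] at this
        linarith

theorem integral_ge (h : ReversingMotion B β q Vinf γ θ t₀ W) (hγ : 0 ≤ γ) (hB : 0 < B)
    (hq : 1 < q) (hθ : 0 ≤ θ) {s t : ℝ} (hs : 0 ≤ s) (hst : s ≤ t) :
    (t - s) * Vinf + γ * ((Real.exp (-B * s) - Real.exp (-B * t)) / B - θ / (q - 1))
      ≤ ∫ σ in s..t, W σ := by
  have hi : IntervalIntegrable (fun σ : ℝ => 1 / (1 + σ) ^ q) volume s t :=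
    ((continuousOn_one_div_one_add_rpow q).mono
      (by rw [uIcc_of_le hst]; exact fun x hx => hs.trans hx.1)).intervalIntegrable
  have hi1 : IntervalIntegrable (fun σ : ℝ => Vinf + γ * Real.exp (-B * σ)) volume s t :=
    Continuous.intervalIntegrable (by fun_prop) _ _
  have hi2 : IntervalIntegrable (fun σ : ℝ => γ * θ * (1 / (1 + σ) ^ q)) volume s t :=
    hi.const_mul _
  have h1 : ∫ σ in s..t, (Vinf + γ * Real.exp (-B * σ) - γ * θ * (1 / (1 + σ) ^ q))
      ≤ ∫ σ in s..t, W σ := by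
    refine intervalIntegral.integral_mono_on hst (hi1.sub hi2) (h.intervalIntegrable hs hst)
      fun σ hσ => le_trans (le_of_eq ?_) (h.lower σ (hs.trans hσ.1))
    ring
  rw [intervalIntegral.integral_sub hi1 hi2, intervalIntegral.integral_add intervalIntegrable_const
    (Continuous.intervalIntegrable (by fun_prop) _ _), intervalIntegral.integral_const_mul,
    intervalIntegral.integral_const_mul, integral_exp_neg_mul hB.ne'] at h1
  have h2 := mul_le_mul_of_nonneg_left (integral_one_div_one_add_rpow_le hq hs hst)
    (mul_nonneg hγ hθ)
  have h3 : ∫ _σ in s..t, Vinf = (t - s) * Vinf := by simp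
  have h4 : γ * θ * (1 / (q - 1)) = γ * (θ / (q - 1)) := by ring
  rw [h3] at h1
  rw [h4] at h2
  linarith

/-- A precollision either happened in the first half of the time elapsed, in which case the
transversal velocity is small, or it happened in the second half, in which case the average of `W`
is taken over late times only. -/
theorem precollision_localization {d : ℕ} {r t : ℝ} (h : ReversingMotion B β q Vinf γ θ t₀ W)
    (hγ : 0 ≤ γ) (hβ : 0 < β) (hB : 0 < B) (hq : 1 < q) (hθ : 0 ≤ θ)
    {y : Perp d} {u : Vel d} (hy : ‖y‖ ≤ r) (hu : (precollisionTimes r W t y u).Nonempty) :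
    (‖u.2‖ ≤ 4 * r / t ∧ -(γ * (2 * θ / (q - 1)) / t) ≤ u.1 - Vinf ∧
        u.1 - Vinf ≤ γ * (2 / β) / t) ∨
      (-(γ * (θ / (1 + t / 2) ^ q)) ≤ u.1 - Vinf ∧
        u.1 - Vinf ≤ γ * Real.exp (-β * (t / 2))) := by
  obtain ⟨s, ⟨hs0, hst⟩, hs, hn⟩ := hu
  have hts : 0 < t - s := sub_pos.2 hst
  have ht : 0 < t := hs0.trans hst
  rcases le_or_gt s (t / 2) with hs2 | hs2
  · left
    have hhalf : t ≤ 2 * (t - s) := by linarith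
    have hup := h.integral_le hγ hβ hs0.le hst.le
    have hlo := h.integral_ge hγ hB hq hθ hs0.le hst.le
    have he : 0 ≤ (Real.exp (-B * s) - Real.exp (-B * t)) / B :=
      div_nonneg (sub_nonneg.2 (Real.exp_le_exp.2 (by nlinarith))) hB.le
    have he' := mul_nonneg hγ he
    rw [hs] at hup hlo
    refine ⟨?_, ?_, ?_⟩
    · have h1 : ‖(t - s) • u.2‖ ≤ 2 * r := by
        have := norm_sub_le y (y - (t - s) • u.2)
        rw [sub_sub_cancel] at this
        linarith
      rw [norm_smul, Real.norm_of_nonneg hts.le] at h1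
      rw [le_div_iff₀ ht]
      nlinarith [norm_nonneg u.2]
    · have h1 : -(γ * (θ / (q - 1))) ≤ (t - s) * (u.1 - Vinf) := by linarith
      have h2 : 0 ≤ γ * (θ / (q - 1)) := mul_nonneg hγ (div_nonneg hθ (by linarith))
      have e : γ * (2 * θ / (q - 1)) / t = 2 * (γ * (θ / (q - 1))) / t := by ring
      rw [neg_le, e, le_div_iff₀ ht]
      rcases le_or_gt 0 (u.1 - Vinf) with hx | hx <;> nlinarith
    · have h1 : (t - s) * (u.1 - Vinf) ≤ γ / β := by linarith
      have h2 : 0 ≤ γ / β := by positivity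
      have e : γ * (2 / β) / t = 2 * (γ / β) / t := by ring
      rw [e, le_div_iff₀ ht]
      rcases le_or_gt 0 (u.1 - Vinf) with hx | hx <;> nlinarith
  · right
    have hup : ∫ σ in s..t, W σ ≤ ∫ _σ in s..t, (Vinf + γ * Real.exp (-β * (t / 2))) := by
      refine intervalIntegral.integral_mono_on hst.le (h.intervalIntegrable hs0.le hst.le)
        intervalIntegrable_const fun σ hσ => (h.upper σ (hs0.le.trans hσ.1)).trans ?_
      have : Real.exp (-β * σ) ≤ Real.exp (-β * (t / 2)) :=
        Real.exp_le_exp.2 (by nlinarith [hσ.1])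
      have := mul_le_mul_of_nonneg_left this hγ
      linarith
    have hlo : ∫ _σ in s..t, (Vinf - γ * (θ / (1 + t / 2) ^ q)) ≤ ∫ σ in s..t, W σ := by
      refine intervalIntegral.integral_mono_on hst.le intervalIntegrable_const
        (h.intervalIntegrable hs0.le hst.le) fun σ hσ =>
          le_trans ?_ (h.lower' hγ (hs0.le.trans hσ.1))
      have h1 : (1 + t / 2) ^ q ≤ (1 + σ) ^ q :=
        Real.rpow_le_rpow (by linarith) (by linarith [hσ.1]) (by linarith)
      have h2 : 0 < (1 + t / 2) ^ q := Real.rpow_pos_of_pos (by linarith) _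
      have := mul_le_mul_of_nonneg_left (div_le_div_of_nonneg_left hθ h2 h1) hγ
      linarith
    rw [hs, intervalIntegral.integral_const, smul_eq_mul] at hup hlo
    constructor
    · have := le_of_mul_le_mul_left hlo hts
      linarith
    · have := le_of_mul_le_mul_left hup hts
      linarith

end ReversingMotion

/-- By the intermediate value theorem, every horizontal velocity strictly between `W(t)` and the
average of `W` over `[0, t]` leads to a precollision, as long as the transversal velocity is
small. -/
theorem precollisionTimes_nonempty {d : ℕ} {r : ℝ} {W : ℝ → ℝ} (hW : ContinuousOn W (Ici 0))
    {t : ℝ} (ht : 0 < t) {y : Perp d} {u : Vel d} (h1 : W t < u.1)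
    (h2 : t * u.1 < ∫ σ in (0 : ℝ)..t, W σ) (h3 : ‖y‖ + t * ‖u.2‖ ≤ r) :
    (precollisionTimes r W t y u).Nonempty := by
  have hdisp : ∀ s, 0 ≤ s → ∫ σ in s..t, W σ = displacement W t - displacement W s :=
    fun s hs => intervalIntegral_eq_displacement_sub hW hs ht.le
  obtain ⟨s₁, ⟨hs₁0, hs₁t⟩, hs₁⟩ : ∃ s₁ ∈ Ioo 0 t, ∀ σ ∈ Icc s₁ t, W σ ≤ u.1 := by
    have hca : ContinuousAt W t := hW.continuousAt (Ici_mem_nhds ht)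
    obtain ⟨ε, hε, hball⟩ := Metric.eventually_nhds_iff.1 (hca.eventually_lt_const h1)
    refine ⟨max (t / 2) (t - ε / 2), ⟨lt_max_of_lt_left (by linarith),
      max_lt (by linarith) (by linarith)⟩, fun σ hσ => (hball ?_).le⟩
    have := (le_max_right _ _).trans hσ.1
    rw [Real.dist_eq, abs_lt]
    constructor <;> linarith [hσ.2]
  let g : ℝ → ℝ := fun s => displacement W t - displacement W s - (t - s) * u.1
  have hg : Continuous g := by
    have := continuous_displacement hW
    fun_prop
  have hg0 : 0 < g 0 := by
    have := hdisp 0 le_rfl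
    simp only [g]
    linarith
  have hg1 : g s₁ ≤ 0 := by
    have hi : IntervalIntegrable W volume s₁ t :=
      (hW.mono (by
        rw [uIcc_of_le hs₁t.le]
        exact fun x hx => hs₁0.le.trans hx.1)).intervalIntegrable
    have := intervalIntegral.integral_mono_on hs₁t.le hi intervalIntegrable_const hs₁
    rw [hdisp s₁ hs₁0.le, intervalIntegral.integral_const, smul_eq_mul] at this
    simp only [g]
    linarith
  obtain ⟨s, hs, hgs⟩ := intermediate_value_Icc' hs₁0.le hg.continuousOn ⟨hg1, hg0.le⟩
  have hs0 : 0 < s := by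
    refine lt_of_le_of_ne hs.1 fun h0 => ?_
    rw [← h0] at hgs
    exact hg0.ne' hgs
  have hst : s < t := hs.2.trans_lt hs₁t
  refine ⟨s, ⟨hs0, hst⟩, ?_, ?_⟩
  · rw [hdisp s hs0.le]
    simp only [g] at hgs
    linarith
  · refine (norm_sub_le _ _).trans (le_trans ?_ h3)
    rw [norm_smul, Real.norm_of_nonneg (sub_pos.2 hst).le]
    have := mul_le_mul_of_nonneg_right (show t - s ≤ t by linarith) (norm_nonneg u.2)
    linarith

/-! ### Layers of precollided velocities -/

theorem exists_exp_neg_mul_le_eventually {β : ℝ} (hβ : 0 < β) (q : ℝ) {ε : ℝ} (hε : 0 < ε) :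
    ∃ T : ℝ, 1 ≤ T ∧ ∀ t, T ≤ t → Real.exp (-β * t) ≤ ε / t ^ q := by
  have := (tendsto_rpow_mul_exp_neg_mul_atTop_nhds_zero q β hβ).eventually_lt_const hε
  obtain ⟨T, hT⟩ := Filter.eventually_atTop.1 this
  refine ⟨max T 1, le_max_right _ _, fun t ht => ?_⟩
  have ht0 : 0 < t := one_pos.trans_le ((le_max_right _ _).trans ht)
  rw [le_div_iff₀ (Real.rpow_pos_of_pos ht0 q), mul_comm]
  exact (hT t ((le_max_left _ _).trans ht)).le

theorem exists_exp_neg_mul_le {β : ℝ} (hβ : 0 < β) {q : ℝ} (hq : 0 ≤ q) :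
    ∃ E : ℝ, 0 < E ∧ ∀ t, 1 ≤ t → Real.exp (-β * t) ≤ E / t ^ q := by
  obtain ⟨T, hT1, hT⟩ := exists_exp_neg_mul_le_eventually hβ q one_pos
  refine ⟨T ^ q, by positivity, fun t ht => ?_⟩
  have ht0 : 0 < t := by linarith
  have hpos := Real.rpow_pos_of_pos ht0 q
  rcases le_total T t with h | h
  · exact (hT t h).trans (div_le_div_of_nonneg_right (Real.one_le_rpow hT1 hq) hpos.le)
  · have h1 : Real.exp (-β * t) ≤ 1 := Real.exp_le_one_iff.2 (by nlinarith)
    refine h1.trans ?_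
    rw [le_div_iff₀ hpos, one_mul]
    exact Real.rpow_le_rpow ht0.le h hq

theorem div_rpow_le_div_self {a t q : ℝ} (ha : 0 ≤ a) (ht : 1 ≤ t) (hq : 1 ≤ q) :
    a / t ^ q ≤ a / t := by
  refine div_le_div_of_nonneg_left ha (by linarith) ?_
  simpa using Real.rpow_le_rpow_of_exponent_le ht hq

theorem div_one_add_half_rpow_le {θ t q : ℝ} (hθ : 0 ≤ θ) (ht : 0 < t) (hq : 0 ≤ q) :
    θ / (1 + t / 2) ^ q ≤ θ * 2 ^ q / t ^ q := by
  have h1 : (t / 2) ^ q ≤ (1 + t / 2) ^ q :=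
    Real.rpow_le_rpow (by positivity) (by linarith) hq
  have h2 : 0 < (t / 2) ^ q := by positivity
  refine (div_le_div_of_nonneg_left hθ h2 h1).trans (le_of_eq ?_)
  rw [Real.div_rpow ht.le (by norm_num), div_div_eq_mul_div]

theorem div_one_add_rpow_le {θ t q : ℝ} (hθ : 0 ≤ θ) (ht : 0 < t) (hq : 0 ≤ q) :
    θ / (1 + t) ^ q ≤ θ / t ^ q :=
  div_le_div_of_nonneg_left hθ (by positivity) (Real.rpow_le_rpow ht.le (by linarith) hq)

/-- At all times precollided velocities lie in layers of thickness `O(γ)`, which shrink with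
time. -/
theorem ReversingMotion.exists_layers {B β q : ℝ} (hB : 0 < B) (hβ : 0 < β) (hq : 1 < q) :
    ∃ Y : ℝ, 0 < Y ∧ ∀ (d : ℕ) (Vinf γ θ t₀ r t : ℝ) (W : ℝ → ℝ),
      ReversingMotion B β q Vinf γ θ t₀ W → 0 < γ → 0 ≤ θ → θ ≤ 1 → 1 ≤ t →
      ∀ (y : Perp d) (u : Vel d), ‖y‖ ≤ r → (precollisionTimes r W t y u).Nonempty →
        (|u.1 - W t| ≤ γ * Y / t ∧ ‖u.2‖ ≤ 4 * r / t) ∨ |u.1 - W t| ≤ γ * Y / t ^ q := by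
  obtain ⟨E, hE, hexp⟩ := exists_exp_neg_mul_le (half_pos hβ) (q := q) (by linarith)
  have hq1 : 0 < q - 1 := by linarith
  have h2q : (0 : ℝ) < 2 ^ q := by positivity
  have hb2 : 0 < 2 / β := by positivity
  have hq2 : 0 < 2 / (q - 1) := by positivity
  refine ⟨2 * E + 1 + 2 ^ q + 2 / β + 2 / (q - 1), by positivity, ?_⟩
  intro d Vinf γ θ t₀ r t W h hγ hθ hθ1 ht y u hy hu
  have ht0 : 0 < t := by linarith
  have htq : 0 < t ^ q := by positivity
  have hup := h.upper t ht0.le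
  have hlo := h.lower' hγ.le ht0.le
  have e1 : Real.exp (-β * (t / 2)) ≤ E / t ^ q := by
    rw [show -β * (t / 2) = -(β / 2) * t by ring]
    exact hexp t ht
  have e2 : Real.exp (-β * t) ≤ E / t ^ q :=
    le_trans (Real.exp_le_exp.2 (by nlinarith)) e1
  have e3 : θ / (1 + t) ^ q ≤ 1 / t ^ q :=
    (div_one_add_rpow_le hθ ht0 (by linarith)).trans (div_le_div_of_nonneg_right hθ1 htq.le)
  have g2 := mul_le_mul_of_nonneg_left e2 hγ.le
  have g3 := mul_le_mul_of_nonneg_left e3 hγ.le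
  rcases h.precollision_localization hγ.le hβ hB hq hθ hy hu with ⟨h1, h2, h3⟩ | ⟨h2, h3⟩
  · left
    refine ⟨?_, h1⟩
    have k1 : E / t ^ q ≤ E / t := div_rpow_le_div_self hE.le ht hq.le
    have k2 : 1 / t ^ q ≤ 1 / t := div_rpow_le_div_self zero_le_one ht hq.le
    have k1' := mul_le_mul_of_nonneg_left k1 hγ.le
    have k2' := mul_le_mul_of_nonneg_left k2 hγ.le
    have k3 : γ * (2 * θ / (q - 1)) / t ≤ γ * (2 / (q - 1)) / t := by
      gcongr
      linarith
    have e : γ * (2 * E + 1 + 2 ^ q + 2 / β + 2 / (q - 1)) / t = γ * (E / t) + γ * (E / t)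
        + γ * (1 / t) + γ * 2 ^ q / t + γ * (2 / β) / t + γ * (2 / (q - 1)) / t := by ring
    have p1 : 0 < γ * (E / t) := by positivity
    have p2 : 0 < γ * (1 / t) := by positivity
    have p3 : 0 < γ * 2 ^ q / t := by positivity
    have p4 : 0 < γ * (2 / β) / t := by positivity
    have p5 : 0 < γ * (2 / (q - 1)) / t := by positivity
    rw [e, abs_le]
    constructor <;> linarith
  · right
    have k1 := div_one_add_half_rpow_le hθ ht0 (by linarith : 0 ≤ q)
    have k2 : θ * 2 ^ q / t ^ q ≤ 2 ^ q / t ^ q := by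
      gcongr
      nlinarith
    have k3 := mul_le_mul_of_nonneg_left (k1.trans k2) hγ.le
    have k4 := mul_le_mul_of_nonneg_left e1 hγ.le
    have e : γ * (2 * E + 1 + 2 ^ q + 2 / β + 2 / (q - 1)) / t ^ q = γ * (E / t ^ q)
        + γ * (E / t ^ q) + γ * (1 / t ^ q) + γ * (2 ^ q / t ^ q) + γ * (2 / β) / t ^ q
        + γ * (2 / (q - 1)) / t ^ q := by ring
    have p1 : 0 < γ * (E / t ^ q) := by positivity
    have p2 : 0 < γ * (1 / t ^ q) := by positivity
    have p3 : 0 < γ * (2 ^ q / t ^ q) := by positivity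
    have p4 : 0 < γ * (2 / β) / t ^ q := by positivity
    have p5 : 0 < γ * (2 / (q - 1)) / t ^ q := by positivity
    rw [e, abs_le]
    constructor <;> linarith

/-- On the right end and for late times the layers are thin compared with `γ`: the initial
exponential part of `W` makes the averages of `W` larger, so only the error term `θ` and the
exponentially small current excess velocity contribute. -/
theorem ReversingMotion.exists_layers_right {B β q ε : ℝ} (hB : 0 < B) (hβ : 0 < β) (hq : 1 < q)
    (hε : 0 < ε) :
    ∃ θ₁ T : ℝ, 0 < θ₁ ∧ 1 ≤ T ∧ ∀ (d : ℕ) (Vinf γ θ t₀ r t : ℝ) (W : ℝ → ℝ),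
      ReversingMotion B β q Vinf γ θ t₀ W → 0 < γ → 0 ≤ θ → θ ≤ θ₁ → T ≤ t →
      ∀ (y : Perp d) (u : Vel d), ‖y‖ ≤ r → u.1 ≤ W t →
        (precollisionTimes r W t y u).Nonempty →
        (|u.1 - W t| ≤ γ * ε / t ∧ ‖u.2‖ ≤ 4 * r / t) ∨ |u.1 - W t| ≤ γ * ε / t ^ q := by
  obtain ⟨T, hT1, hexp⟩ := exists_exp_neg_mul_le_eventually hβ q (half_pos hε)
  have hq1 : 0 < q - 1 := by linarith
  have h2q : (0 : ℝ) < 2 ^ q := by positivity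
  refine ⟨min (ε * (q - 1) / 4) (ε / (2 * 2 ^ q)), T, by positivity, hT1, ?_⟩
  intro d Vinf γ θ t₀ r t W h hγ hθ hθ1 htT y u hy huW hu
  have ht : 1 ≤ t := hT1.trans htT
  have ht0 : 0 < t := by linarith
  have htq : 0 < t ^ q := by positivity
  have hup := h.upper t ht0.le
  have e2 := mul_le_mul_of_nonneg_left (hexp t htT) hγ.le
  have t1 : 2 * θ / (q - 1) ≤ ε / 2 := by
    have := hθ1.trans (min_le_left _ _)
    rw [div_le_iff₀ hq1]
    linarith
  have t2 : θ * 2 ^ q ≤ ε / 2 := by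
    have := hθ1.trans (min_le_right _ _)
    rw [le_div_iff₀ (by positivity)] at this
    linarith
  rw [abs_of_nonpos (by linarith : u.1 - W t ≤ 0)]
  rcases h.precollision_localization hγ.le hβ hB hq hθ hy hu with ⟨h1, h2, -⟩ | ⟨h2, -⟩
  · left
    refine ⟨?_, h1⟩
    have k1' := mul_le_mul_of_nonneg_left
      (div_rpow_le_div_self (half_pos hε).le ht hq.le) hγ.le
    have k3 : γ * (2 * θ / (q - 1)) / t ≤ γ * (ε / 2) / t := by gcongr
    have e : γ * ε / t = γ * (ε / 2 / t) + γ * (ε / 2) / t := by ring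
    linarith
  · right
    have k1 := div_one_add_half_rpow_le hθ ht0 (by linarith : 0 ≤ q)
    have k2 : θ * 2 ^ q / t ^ q ≤ ε / 2 / t ^ q := div_le_div_of_nonneg_right t2 htq.le
    have k3 := mul_le_mul_of_nonneg_left (k1.trans k2) hγ.le
    have e : γ * ε / t ^ q = γ * (ε / 2 / t ^ q) + γ * (ε / 2 / t ^ q) := by ring
    linarith

/-- After the reversal, the average of `W` over `[0, t]` exceeds `W(t)` by at least a multiple of
`γ / t`. -/
theorem ReversingMotion.exists_gap {B β q : ℝ} (hB : 0 < B) (hβ : 0 < β) (hq : 1 < q) :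
    ∃ θ₁ T : ℝ, 0 < θ₁ ∧ 1 ≤ T ∧ ∀ (Vinf γ θ t₀ t : ℝ) (W : ℝ → ℝ),
      ReversingMotion B β q Vinf γ θ t₀ W → 0 < γ → 0 ≤ θ → θ ≤ θ₁ → T ≤ t →
      t * (W t + γ * (1 / (4 * B)) / t) ≤ ∫ σ in (0 : ℝ)..t, W σ := by
  obtain ⟨T₁, hT₁, hexp₁⟩ := exists_exp_neg_mul_le_eventually hB 0 (half_pos one_pos)
  obtain ⟨T₂, hT₂, hexp₂⟩ := exists_exp_neg_mul_le_eventually hβ 1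
    (show 0 < 1 / (8 * B) by positivity)
  have hq1 : 0 < q - 1 := by linarith
  refine ⟨(q - 1) / (8 * B), max T₁ T₂, by positivity, hT₁.trans (le_max_left _ _), ?_⟩
  intro Vinf γ θ t₀ t W h hγ hθ hθ1 ht
  have ht1 : 1 ≤ t := hT₁.trans ((le_max_left _ _).trans ht)
  have ht0 : 0 < t := by linarith
  have e1 := hexp₁ t ((le_max_left _ _).trans ht)
  have e2 := hexp₂ t ((le_max_right _ _).trans ht)
  rw [Real.rpow_zero, div_one] at e1
  rw [Real.rpow_one, le_div_iff₀ ht0] at e2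
  have hint := h.integral_ge hγ.le hB hq hθ le_rfl ht0.le
  have hup := mul_le_mul_of_nonneg_left (h.upper t ht0.le) ht0.le
  have k1 : 1 / (2 * B) ≤ (Real.exp (-B * 0) - Real.exp (-B * t)) / B := by
    rw [mul_zero, Real.exp_zero, div_le_div_iff₀ (by positivity) hB]
    nlinarith
  have k2 : θ / (q - 1) ≤ 1 / (8 * B) := by
    rw [div_le_iff₀ hq1]
    refine hθ1.trans (le_of_eq ?_)
    ring
  have k3 : 1 / (4 * B) + 1 / (8 * B) ≤
      (Real.exp (-B * 0) - Real.exp (-B * t)) / B - θ / (q - 1) := by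
    have : 1 / (4 * B) + 1 / (8 * B) = 1 / (2 * B) - 1 / (8 * B) := by
      field_simp
      norm_num
    linarith
  have k4 := mul_le_mul_of_nonneg_left k3 hγ.le
  have k5 := mul_le_mul_of_nonneg_left e2 hγ.le
  have k6 : t * (W t + γ * (1 / (4 * B)) / t) = t * W t + γ * (1 / (4 * B)) := by
    field_simp
  rw [k6]
  linarith

/-! ### Bounds for the precollision force -/

theorem integrableOn_and_abs_setIntegral_le {X : Type*} [MeasurableSpace X] {μ : Measure X}
    {F : X → ℝ} {S : Set X} {c : ℝ} (hm : Measurable F) (hc : 0 ≤ c)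
    (h : ∫⁻ z in S, ‖F z‖ₑ ∂μ ≤ ENNReal.ofReal c) :
    IntegrableOn F S μ ∧ |∫ z in S, F z ∂μ| ≤ c := by
  refine ⟨⟨hm.aestronglyMeasurable, h.trans_lt ENNReal.ofReal_lt_top⟩, ?_⟩
  have := (enorm_integral_le_lintegral_enorm (μ := μ.restrict S) F).trans h
  rwa [← ofReal_norm, ENNReal.ofReal_le_ofReal_iff hc, Real.norm_eq_abs] at this

theorem precollisionForce_eq {d : ℕ} {K : Vel d → Vel d → ℝ} {f₀ : Vel d → ℝ} {r : ℝ} {W : ℝ → ℝ}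
    {t : ℝ} (h : ∀ e : Side, IntegrableOn
      (fun z : Perp d × Vel d => forceIntegrand K f₀ r W e t z.1 z.2)
      (Metric.closedBall (0 : Perp d) r ×ˢ e.incoming d (W t))) :
    precollisionForce K f₀ r W t =
      (∫ z in Metric.closedBall (0 : Perp d) r ×ˢ Side.left.incoming d (W t),
        -forceIntegrand K f₀ r W Side.left t z.1 z.2) +
      ∫ z in Metric.closedBall (0 : Perp d) r ×ˢ Side.right.incoming d (W t),
        forceIntegrand K f₀ r W Side.right t z.1 z.2 := by
  have h1 := setIntegral_prod (μ := (volume : Measure (Perp d)))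
    (ν := (volume : Measure (Vel d))) _ (h Side.left).neg
  have h2 := setIntegral_prod (μ := (volume : Measure (Perp d)))
    (ν := (volume : Measure (Vel d))) _ (h Side.right)
  rw [precollisionForce]
  exact congrArg₂ (· + ·) h1.symm h2.symm

theorem rpow_add_dim {d : ℕ} (hd : 1 ≤ d) (p : ℝ) {t : ℝ} (ht : 0 < t) :
    t ^ (p + (d : ℝ)) = t ^ (p + 1) * t ^ (d - 1) := by
  rw [← Real.rpow_natCast t (d - 1), ← Real.rpow_add ht, Nat.cast_sub hd]
  congr 1
  push_cast
  ring

theorem layers_rpow_eq {d : ℕ} (hd : 1 ≤ d) {p D r t : ℝ} (hD : 0 ≤ D) (ht : 0 < t) :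
    (D / t) ^ (p + 1) * (4 * r / t) ^ (d - 1) =
      (4 * r) ^ (d - 1) * (D ^ (p + 1) / t ^ (p + d)) := by
  rw [Real.div_rpow hD ht.le, div_pow, rpow_add_dim hd p ht]
  field_simp

theorem rpow_div_rpow_le {p q D t : ℝ} (hp : 0 ≤ p) (hq : 0 ≤ q) (hD : 0 ≤ D) (ht : 1 ≤ t) :
    (D / t ^ q) ^ (p + 1) ≤ D ^ (p + 1) / t ^ q := by
  have ht0 : 0 < t := by linarith
  rw [Real.div_rpow hD (by positivity)]
  refine div_le_div_of_nonneg_left (by positivity) (by positivity) ?_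
  have := Real.rpow_le_rpow_of_exponent_le (Real.one_le_rpow ht hq)
    (by linarith : (1 : ℝ) ≤ p + 1)
  rwa [Real.rpow_one] at this

/-- The two-sided estimate of the precollision force for the motions of the reversal class. -/
theorem exists_precollisionForce_bounds {d : ℕ} (hd : 1 ≤ d) {r : ℝ} (hr : 0 < r)
    {k : ℝ → ℝ → ℝ} {a₀ : ℝ → ℝ} {b : Perp d → ℝ} {p Vinf γ₀ : ℝ} (hγ₀ : 0 < γ₀)
    (h : GasAssumptions k a₀ b p Vinf γ₀) (hrev : ReversalCriterion k a₀ Vinf) {B β : ℝ}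
    (hB : 0 < B) (hβ : 0 < β) :
    ∃ c C γ₁ θ₁ T : ℝ, 0 < c ∧ 0 < C ∧ 0 < γ₁ ∧ 0 < θ₁ ∧ 0 < T ∧
      ∀ (γ θ t₀ : ℝ) (W : ℝ → ℝ), 0 < γ → γ ≤ γ₁ → 0 ≤ θ → θ ≤ θ₁ → T ≤ t₀ →
        ReversingMotion B β (p + d) Vinf γ θ t₀ W → ∀ t, 0 ≤ t →
        (∀ e : Side, IntegrableOn (fun z : Perp d × Vel d =>
            forceIntegrand (collisionKernel k b) (initialDensity a₀ b) r W e t z.1 z.2)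
          (Metric.closedBall (0 : Perp d) r ×ˢ e.incoming d (W t))) ∧
        (t < t₀ → 0 ≤ precollisionForce (collisionKernel k b) (initialDensity a₀ b) r W t) ∧
        (t₀ ≤ t → c * γ ^ (p + 1) / t ^ (p + d) ≤
          precollisionForce (collisionKernel k b) (initialDensity a₀ b) r W t) ∧
        precollisionForce (collisionKernel k b) (initialDensity a₀ b) r W t
          ≤ C * γ ^ (p + 1) / (1 + t) ^ (p + d) := by
  have hd' : (1 : ℝ) ≤ d := by exact_mod_cast hd
  have hp := h.p_pos
  have hq : 1 < p + (d : ℝ) := by linarith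
  have hq0 : 0 ≤ p + (d : ℝ) := by linarith
  obtain ⟨Cf, δ, η₀, hCf, hδ, hη₀, hF⟩ := h.exists_forceIntegrand_bounds hγ₀ hrev
  obtain ⟨CΛ, hCΛ, hlay⟩ := h.exists_lintegral_layers_le r (4 * r) hr
  obtain ⟨cl, ρ, hcl, hρ, hρr, hlow⟩ := h.exists_le_setIntegral_layer hr
  obtain ⟨Y, hY, hlayers⟩ := ReversingMotion.exists_layers hB hβ hq
  set κ : ℝ := 1 / (4 * B) with hκ
  have hκ0 : 0 < κ := by positivity
  set Λ : ℝ := CΛ * Cf * ((4 * r) ^ (d - 1) + 1) with hΛ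
  have hΛ0 : 0 < Λ := by positivity
  -- the relative thickness of the layers on the right end, for which their contribution is at
  -- most half of that of the left end
  set c : ℝ := cl * δ * κ ^ (p + 1) / 2 with hc
  have hc0 : 0 < c := by positivity
  obtain ⟨ε, hε, hεc⟩ : ∃ ε : ℝ, 0 < ε ∧ Λ * ε ^ (p + 1) ≤ c := by
    refine ⟨(c / Λ) ^ (1 / (p + 1)), by positivity, ?_⟩
    rw [← Real.rpow_mul (by positivity), one_div_mul_cancel (by linarith), Real.rpow_one]
    exact (mul_div_cancel₀ c hΛ0.ne').le
  obtain ⟨θ₂, T₂, hθ₂, hT₂, hright⟩ := ReversingMotion.exists_layers_right hB hβ hq hε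
  obtain ⟨θ₃, T₃, hθ₃, hT₃, hgap⟩ := ReversingMotion.exists_gap hB hβ hq
  set C₁ : ℝ := CΛ * Cf * 2 ^ (p + 1) with hC₁
  have hC₁0 : 0 < C₁ := by positivity
  refine ⟨c, 2 * 2 ^ (p + d) * (C₁ + Λ * Y ^ (p + 1)), η₀, min 1 (min θ₂ θ₃), max T₂ T₃, hc0,
    by positivity, hη₀, by positivity, by positivity, ?_⟩
  intro γ θ t₀ W hγ hγη hθ hθ₁ hT hW t ht
  have hθ1 : θ ≤ 1 := hθ₁.trans (min_le_left _ _)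
  have hθ2 : θ ≤ θ₂ := hθ₁.trans ((min_le_right _ _).trans (min_le_left _ _))
  have hθ3 : θ ≤ θ₃ := hθ₁.trans ((min_le_right _ _).trans (min_le_right _ _))
  have hWc := hW.continuousOn
  have hWγ : ∀ t, 0 ≤ t → |W t - Vinf| ≤ γ := fun t ht =>
    hW.abs_sub_le hγ.le hβ.le hq0 hθ hθ1 ht
  rcases ht.eq_or_lt with rfl | ht0
  · -- at time `0` there are no precollisions
    have hz : ∀ e (y : Perp d) (u : Vel d),
        forceIntegrand (collisionKernel k b) (initialDensity a₀ b) r W e 0 y u = 0 := by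
      intro e y u
      refine h.forceIntegrand_eq_zero ?_
      rw [precollisionTimes_eq_empty le_rfl]
      simp
    have hR : precollisionForce (collisionKernel k b) (initialDensity a₀ b) r W 0 = 0 := by
      simp [precollisionForce, hz]
    refine ⟨fun e => ?_, fun _ => hR.ge, fun h0 => absurd h0 ?_, ?_⟩
    · simp only [hz]
      exact integrableOn_zero
    · have : 1 ≤ max T₂ T₃ := hT₂.trans (le_max_left _ _)
      linarith
    · rw [hR]
      positivity
  set F : Side → Perp d × Vel d → ℝ := fun e z =>
    forceIntegrand (collisionKernel k b) (initialDensity a₀ b) r W e t z.1 z.2 with hFdef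
  have hFm : ∀ e, Measurable (F e) := fun e => h.measurable_forceIntegrand hWc e ht0
  have hFb := fun y u => hF r γ W hγη hWc hWγ t y u ht0
  have hS : ∀ e, MeasurableSet (Side.incoming d (W t) e) := fun e => measurableSet_incoming _ e
  have hF0 : ∀ e y u, ¬(precollisionTimes r W t y u).Nonempty → F e (y, u) = 0 :=
    fun e y u hu => h.forceIntegrand_eq_zero fun hu' => hu hu'.1
  -- the contribution of layers of relative thickness `D`
  have hlayD : ∀ (e : Side) (D : ℝ), 0 ≤ D → 1 ≤ t →
      (∀ (y : Perp d) (u : Vel d), ‖y‖ ≤ r → u ∈ Side.incoming d (W t) e →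
        (precollisionTimes r W t y u).Nonempty →
        (|u.1 - W t| ≤ γ * D / t ∧ ‖u.2‖ ≤ 4 * r / t) ∨
          |u.1 - W t| ≤ γ * D / t ^ (p + (d : ℝ))) →
      IntegrableOn (F e) (Metric.closedBall (0 : Perp d) r ×ˢ Side.incoming d (W t) e) ∧
      |∫ z in Metric.closedBall (0 : Perp d) r ×ˢ Side.incoming d (W t) e, F e z|
        ≤ Λ * D ^ (p + 1) * (γ ^ (p + 1) / t ^ (p + d)) := by
    intro e D hD ht1 hl
    refine integrableOn_and_abs_setIntegral_le (hFm e) (by positivity)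
      ((hlay (F e) (W t) (γ * D / t) (γ * D / t ^ (p + (d : ℝ))) (4 * r / t) Cf _ (hS e)
        (by positivity) (by positivity) (by positivity) (div_le_self (by positivity) ht1) hCf.le
        fun y u hy hu => ?_).trans (ENNReal.ofReal_le_ofReal ?_))
    · by_cases hne : (precollisionTimes r W t y u).Nonempty
      · exact Or.inr ⟨(hFb y u).1 e, hl y u hy hu hne⟩
      · exact Or.inl (hF0 e y u hne)
    · rw [layers_rpow_eq hd (by positivity) ht0]
      have h1 := rpow_div_rpow_le hp.le hq0 (mul_nonneg hγ.le hD) ht1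
      have h2 : (γ * D) ^ (p + 1) = γ ^ (p + 1) * D ^ (p + 1) := Real.mul_rpow hγ.le hD
      have h3 := mul_le_mul_of_nonneg_left h1 (mul_pos hCΛ hCf).le
      rw [h2] at h3 ⊢
      rw [hΛ]
      refine le_of_eq_of_le (mul_add _ _ _) ((add_le_add le_rfl h3).trans (le_of_eq ?_))
      ring
  have hboth : ∀ e : Side,
      IntegrableOn (F e) (Metric.closedBall (0 : Perp d) r ×ˢ Side.incoming d (W t) e) ∧
      |∫ z in Metric.closedBall (0 : Perp d) r ×ˢ Side.incoming d (W t) e, F e z|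
        ≤ 2 ^ (p + (d : ℝ)) * (C₁ + Λ * Y ^ (p + 1)) * γ ^ (p + 1) / (1 + t) ^ (p + d) := by
    intro e
    have hpow : (0 : ℝ) < 2 ^ (p + (d : ℝ)) := by positivity
    have hYp : 0 < Λ * Y ^ (p + 1) := by positivity
    rcases le_total t 1 with ht1 | ht1
    · have hb : (1 + t) ^ (p + (d : ℝ)) ≤ 2 ^ (p + (d : ℝ)) :=
        Real.rpow_le_rpow (by linarith) (by linarith) hq0
      have hb0 : (0 : ℝ) < (1 + t) ^ (p + (d : ℝ)) := by positivity
      have hres := integrableOn_and_abs_setIntegral_le (c := C₁ * γ ^ (p + 1)) (hFm e)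
        (by positivity) ((hlay (F e) (W t) 0 (2 * γ) 0 Cf _ (hS e) le_rfl (by positivity) le_rfl
          (by positivity) hCf.le fun y u _ _ => ?_).trans (ENNReal.ofReal_le_ofReal ?_))
      · refine ⟨hres.1, hres.2.trans ?_⟩
        rw [le_div_iff₀ hb0]
        have h1 : C₁ * γ ^ (p + 1) ≤ (C₁ + Λ * Y ^ (p + 1)) * γ ^ (p + 1) := by
          have : 0 < γ ^ (p + 1) := by positivity
          nlinarith
        calc _ ≤ (C₁ + Λ * Y ^ (p + 1)) * γ ^ (p + 1) * 2 ^ (p + (d : ℝ)) :=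
              mul_le_mul h1 hb hb0.le (by positivity)
          _ = _ := by ring
      · by_cases hne : (precollisionTimes r W t y u).Nonempty
        · refine Or.inr ⟨(hFb y u).1 e, Or.inr ?_⟩
          have h1 := abs_sub_le_of_precollision hWc hWγ hne
          have h2 := hWγ t ht0.le
          rw [abs_le] at *
          constructor <;> linarith
        · exact Or.inl (hF0 e y u hne)
      · rw [Real.zero_rpow (by linarith), zero_mul, zero_add,
          Real.mul_rpow (by norm_num) hγ.le, hC₁, mul_assoc]
        exact le_of_eq (by ring)
    · obtain ⟨h1, h2⟩ := hlayD e Y hY.le ht1 fun y u hy _ hne =>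
        hlayers d Vinf γ θ t₀ r t W hW hγ hθ hθ1 ht1 y u hy hne
      refine ⟨h1, h2.trans ?_⟩
      have htq : 0 < t ^ (p + (d : ℝ)) := by positivity
      have hb : (1 + t) ^ (p + (d : ℝ)) ≤ 2 ^ (p + (d : ℝ)) * t ^ (p + (d : ℝ)) := by
        rw [← Real.mul_rpow (by norm_num) ht0.le]
        exact Real.rpow_le_rpow (by linarith) (by linarith) hq0
      have hb0 : (0 : ℝ) < (1 + t) ^ (p + (d : ℝ)) := by positivity
      rw [le_div_iff₀ hb0, mul_div_assoc', div_mul_eq_mul_div, div_le_iff₀ htq]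
      calc Λ * Y ^ (p + 1) * γ ^ (p + 1) * (1 + t) ^ (p + (d : ℝ))
          ≤ (C₁ + Λ * Y ^ (p + 1)) * γ ^ (p + 1) * (2 ^ (p + (d : ℝ)) * t ^ (p + (d : ℝ))) := by
            gcongr
            linarith
        _ = _ := by ring
  have hint := fun e => (hboth e).1
  have hReq := precollisionForce_eq hint
  have hleft0 : ∀ z, F Side.left z ≤ 0 := fun z => (hFb z.1 z.2).2.1
  refine ⟨hint, fun htt₀ => ?_, fun htt₀ => ?_, ?_⟩
  · rw [hReq]
    refine add_nonneg (integral_nonneg fun z => neg_nonneg.2 (hleft0 z)) (le_of_eq ?_)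
    -- as `W` decreases, no average of `W` is below `W(t)`
    refine (setIntegral_eq_zero_of_forall_eq_zero ?_).symm
    rintro ⟨y, u⟩ ⟨-, hu⟩
    have hu' : u.1 ≤ W t := hu
    by_cases hne : (precollisionTimes r W t y u).Nonempty
    · refine h.forceIntegrand_eq_zero_of_eq hγ₀ (le_antisymm hu' ?_)
      obtain ⟨s, ⟨hs0, hst⟩, hs, -⟩ := hne
      have hmono : ∫ _σ in s..t, W t ≤ ∫ σ in s..t, W σ :=
        intervalIntegral.integral_mono_on hst.le intervalIntegrable_const
          (hW.intervalIntegrable hs0.le hst.le) fun σ hσ =>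
            hW.decreasing ⟨hs0.le.trans hσ.1, hσ.2.trans htt₀.le⟩ ⟨ht0.le, htt₀.le⟩ hσ.2
      rw [hs, intervalIntegral.integral_const, smul_eq_mul] at hmono
      exact le_of_mul_le_mul_left hmono (sub_pos.2 hst)
    · exact hF0 _ y u hne
  · have htT : max T₂ T₃ ≤ t := hT.trans htt₀
    have ht1 : 1 ≤ t := hT₂.trans ((le_max_left _ _).trans htT)
    have hgt := hgap Vinf γ θ t₀ t W hW hγ hθ hθ3 ((le_max_right _ _).trans htT)
    have hL := hlow (F Side.left) (W t) (γ * κ / t) t δ (by positivity) ht1 hδ.le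
      (hint Side.left) hleft0 fun y u hy hu1 hu2 hu3 => by
        have hgt1 : W t < u.1 := by
          have : 0 < γ * κ / t / 2 := by positivity
          linarith
        refine (hFb y u).2.2 (precollisionTimes_nonempty hWc ht0 hgt1 ?_ ?_) hgt1.ne'
        · exact (mul_lt_mul_of_pos_left hu2 ht0).trans_le hgt
        · rw [le_div_iff₀ ht0] at hu3
          linarith
    obtain ⟨-, hR⟩ := hlayD Side.right ε hε.le ht1 fun y u hy hu hne =>
      hright d Vinf γ θ t₀ r t W hW hγ hθ hθ2 ((le_max_left _ _).trans htT) y u hy hu hne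
    have hR' := (abs_le.1 hR).1
    have hpos : 0 < γ ^ (p + 1) / t ^ (p + (d : ℝ)) := by positivity
    have hL' : cl * δ * (γ * κ / t) ^ (p + 1) / t ^ (d - 1)
        = 2 * c * (γ ^ (p + 1) / t ^ (p + (d : ℝ))) := by
      rw [Real.div_rpow (by positivity) ht0.le, Real.mul_rpow hγ.le hκ0.le,
        rpow_add_dim hd p ht0, hc]
      field_simp
    rw [hL'] at hL
    rw [hReq, mul_div_assoc]
    have := mul_le_mul_of_nonneg_right hεc hpos.le
    change _ ≤ (∫ z in _, -F Side.left z) + ∫ z in _, F Side.right z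
    linarith
  · rw [hReq]
    have h1 := (abs_le.1 (hboth Side.left).2).1
    have h2 := (abs_le.1 (hboth Side.right).2).2
    change (∫ z in _, -F Side.left z) + (∫ z in _, F Side.right z) ≤ _
    rw [integral_neg]
    have e : 2 * 2 ^ (p + (d : ℝ)) * (C₁ + Λ * Y ^ (p + 1)) * γ ^ (p + 1) / (1 + t) ^ (p + (d : ℝ))
        = 2 * (2 ^ (p + (d : ℝ)) * (C₁ + Λ * Y ^ (p + 1)) * γ ^ (p + 1)
          / (1 + t) ^ (p + (d : ℝ))) := by ring
    rw [e]
    linarith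

/-! ### The slope of the free force -/

section Gas

variable {d : ℕ} {k : ℝ → ℝ → ℝ} {a₀ : ℝ → ℝ} {b : Perp d → ℝ} {p Vinf γ₀ : ℝ}

/-- The odd function `sign(w) ℓ(w)`. -/
def signedMoment (k : ℝ → ℝ → ℝ) (w : ℝ) : ℝ :=
  if 0 ≤ w then longitudinalMoment k w else -longitudinalMoment k w

theorem GasAssumptions.sq_sub_sq_le_signedMoment_sub (h : GasAssumptions k a₀ b p Vinf γ₀)
    {v w : ℝ} (hvw : v ≤ w) (hw : w < 0) : v ^ 2 - w ^ 2 ≤ signedMoment k w - signedMoment k v := by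
  have hv : v < 0 := hvw.trans_lt hw
  have := h.moment_strictAnti.antitoneOn hv hw hvw
  simp only [signedMoment, if_neg (not_le.2 hv), if_neg (not_le.2 hw), longitudinalMoment]
  linarith

theorem GasAssumptions.monotone_signedMoment (h : GasAssumptions k a₀ b p Vinf γ₀)
    (hγ₀ : 0 < γ₀) : Monotone (signedMoment k) := by
  intro v w hvw
  rcases lt_or_ge w 0 with hw | hw
  · have := h.sq_sub_sq_le_signedMoment_sub hvw hw
    nlinarith
  · have hw' : signedMoment k w = longitudinalMoment k w := if_pos hw
    have hwn := h.longitudinalMoment_nonneg w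
    rcases lt_or_ge v 0 with hv | hv
    · have hv' : signedMoment k v = -longitudinalMoment k v := if_neg (not_le.2 hv)
      have := h.longitudinalMoment_nonneg v
      linarith
    · have hv' : signedMoment k v = longitudinalMoment k v := if_pos hv
      rw [hw', hv']
      rcases hv.eq_or_lt with rfl | hv0
      · rwa [h.longitudinalMoment_zero hγ₀]
      · have := h.moment_strictAnti.antitoneOn (show -w ∈ Iio (0 : ℝ) from by
          simpa using hv0.trans_le hvw) (show -v ∈ Iio (0 : ℝ) from by simpa using hv0)
          (neg_le_neg hvw)
        rw [h.secondMoment_even, h.secondMoment_even] at this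
        unfold longitudinalMoment
        nlinarith

theorem GasAssumptions.longitudinalMoment_even (h : GasAssumptions k a₀ b p Vinf γ₀) (u : ℝ) :
    longitudinalMoment k (-u) = longitudinalMoment k u := by
  rw [longitudinalMoment, longitudinalMoment, h.secondMoment_even, neg_sq]

theorem GasAssumptions.freeForce_eq (h : GasAssumptions k a₀ b p Vinf γ₀) (hγ₀ : 0 < γ₀)
    (r V : ℝ) (hint : Integrable
      (fun u : Vel d => ell (collisionKernel k b) (u - horiz d V) * initialDensity a₀ b u)) :
    Integrable (fun u : Vel d => signedMoment k (V - u.1) * initialDensity a₀ b u) ∧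
    freeForce (collisionKernel k b) (initialDensity a₀ b) r V =
      (volume : Measure (Perp d)).real (Metric.closedBall 0 r) *
        ∫ u : Vel d, signedMoment k (V - u.1) * initialDensity a₀ b u := by
  have hset1 : MeasurableSet {u : Vel d | u.1 ≤ V} :=
    measurableSet_le measurable_fst measurable_const
  have hset2 : MeasurableSet {u : Vel d | V ≤ u.1} :=
    measurableSet_le measurable_const measurable_fst
  have hpt : (fun u : Vel d => signedMoment k (V - u.1) * initialDensity a₀ b u) = fun u : Vel d =>
      {u : Vel d | u.1 ≤ V}.indicator
        (fun u => ell (collisionKernel k b) (u - horiz d V) * initialDensity a₀ b u) u -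
      {u : Vel d | V ≤ u.1}.indicator
        (fun u => ell (collisionKernel k b) (u - horiz d V) * initialDensity a₀ b u) u := by
    ext u
    have hell : ell (collisionKernel k b) (u - horiz d V) = longitudinalMoment k (V - u.1) := by
      rw [h.ell_eq, ← h.longitudinalMoment_even]
      simp [horiz]
    rcases lt_trichotomy u.1 V with hu | hu | hu
    · rw [indicator_of_mem (by exact hu.le), indicator_of_notMem (by simpa using hu), hell,
        signedMoment, if_pos (by linarith), sub_zero]
    · rw [indicator_of_mem (by exact hu.le), indicator_of_mem (by exact hu.ge), sub_self,
        signedMoment, hu, sub_self, if_pos le_rfl, h.longitudinalMoment_zero hγ₀, zero_mul]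
    · rw [indicator_of_notMem (by simpa using hu), indicator_of_mem (by exact hu.le), hell,
        signedMoment, if_neg (by linarith), zero_sub, neg_mul]
  rw [hpt]
  refine ⟨(hint.indicator hset1).sub (hint.indicator hset2), ?_⟩
  rw [integral_sub (hint.indicator hset1) (hint.indicator hset2), integral_indicator hset1,
    integral_indicator hset2, freeForce, setIntegral_const, setIntegral_const, smul_eq_mul,
    smul_eq_mul, mul_sub]

/-- The quadratic part of `ℓ` makes the free force increase at a positive rate, since the gas has
positive density near the velocity `Vinf`. -/
theorem GasAssumptions.deriv_freeForce_pos (h : GasAssumptions k a₀ b p Vinf γ₀) (hγ₀ : 0 < γ₀)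
    {r : ℝ} (hr : 0 < r) (ha : 0 < a₀ Vinf)
    (hF_finite : ∀ V ∈ Ioo (Vinf - γ₀) (Vinf + γ₀), Integrable
      (fun u : Vel d => ell (collisionKernel k b) (u - horiz d V) * initialDensity a₀ b u))
    (hdiff : DifferentiableAt ℝ (freeForce (collisionKernel k b) (initialDensity a₀ b) r) Vinf) :
    0 < deriv (freeForce (collisionKernel k b) (initialDensity a₀ b) r) Vinf := by
  set Φ := freeForce (collisionKernel k b) (initialDensity a₀ b) r with hΦ
  set ω := (volume : Measure (Perp d)).real (Metric.closedBall 0 r) with hω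
  have hω0 : 0 < ω :=
    ENNReal.toReal_pos (Metric.measure_closedBall_pos _ _ hr).ne'
      (isCompact_closedBall _ _).measure_lt_top.ne
  obtain ⟨ε₀, hε₀, hcont⟩ := Metric.continuous_iff.1 h.a₀_continuous Vinf (a₀ Vinf / 2)
    (by linarith)
  set ε := min (ε₀ / 3) (γ₀ / 2) with hε
  have hεpos : 0 < ε := by positivity
  have hε1 : ε ≤ ε₀ / 3 := min_le_left _ _
  have hε2 : ε ≤ γ₀ / 2 := min_le_right _ _
  -- velocities in a window to the right of `Vinf` already contribute a positive slope
  let J : Set ℝ := Ioc (Vinf + ε) (Vinf + 2 * ε)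
  have hJa : ∀ z ∈ J, a₀ Vinf / 2 ≤ a₀ z := by
    intro z hz
    have := hcont z (by rw [Real.dist_eq, abs_lt]; constructor <;> linarith [hz.1, hz.2])
    rw [Real.dist_eq, abs_lt] at this
    linarith
  have hJint : IntegrableOn a₀ J :=
    (h.a₀_continuous.integrableOn_Icc (a := Vinf + ε) (b := Vinf + 2 * ε)).mono_set
      Ioc_subset_Icc_self
  have hwin : Integrable fun u : Vel d => J.indicator a₀ u.1 * b u.2 :=
    (hJint.integrable_indicator measurableSet_Ioc).mul_prod h.integrable_b
  have hwin_val : ε * (a₀ Vinf / 2) ≤ ∫ u : Vel d, J.indicator a₀ u.1 * b u.2 := by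
    rw [Measure.volume_eq_prod, integral_prod_mul (J.indicator a₀) b, h.b_integral, mul_one,
      integral_indicator measurableSet_Ioc]
    have := setIntegral_ge_of_const_le_real measurableSet_Ioc (by simp) hJa hJint
    rwa [Real.volume_real_Ioc_of_le (by linarith), mul_comm,
      show Vinf + 2 * ε - (Vinf + ε) = ε by ring] at this
  have hslope : ∀ V ∈ Ioo Vinf (Vinf + ε),
      ω * (ε * (ε * (a₀ Vinf / 2))) ≤ slope Φ Vinf V := by
    intro V hV
    have hVpos : 0 < V - Vinf := sub_pos.2 hV.1
    obtain ⟨hi1, he1⟩ := h.freeForce_eq hγ₀ r Vinf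
      (hF_finite Vinf ⟨by linarith, by linarith⟩)
    obtain ⟨hi2, he2⟩ := h.freeForce_eq hγ₀ r V
      (hF_finite V ⟨by linarith [hV.1], by linarith [hV.2]⟩)
    have hmono : ∫ u : Vel d, (V - Vinf) * ε * (J.indicator a₀ u.1 * b u.2) ≤
        ∫ u : Vel d, (signedMoment k (V - u.1) * initialDensity a₀ b u -
          signedMoment k (Vinf - u.1) * initialDensity a₀ b u) := by
      refine integral_mono (hwin.const_mul _) (hi2.sub hi1) fun u => ?_
      have hf := h.initialDensity_nonneg u
      have hm := h.monotone_signedMoment hγ₀ (show Vinf - u.1 ≤ V - u.1 by linarith [hV.1])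
      dsimp only
      rw [← sub_mul]
      by_cases hu : u.1 ∈ J
      · rw [indicator_of_mem hu]
        have h1 := h.sq_sub_sq_le_signedMoment_sub (show Vinf - u.1 ≤ V - u.1 by linarith [hV.1])
          (by linarith [hV.2, hu.1])
        have h2 : (V - Vinf) * ε ≤ (Vinf - u.1) ^ 2 - (V - u.1) ^ 2 := by
          nlinarith [hV.2, hu.1]
        exact mul_le_mul_of_nonneg_right (h2.trans h1) hf
      · rw [indicator_of_notMem hu, zero_mul, mul_zero]
        exact mul_nonneg (sub_nonneg.2 hm) hf
    rw [integral_const_mul, integral_sub hi2 hi1] at hmono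
    rw [slope_def_field, le_div_iff₀ hVpos, hΦ, he1, he2, ← mul_sub]
    have h3 := mul_le_mul_of_nonneg_left hwin_val (mul_pos hVpos hεpos).le
    have h4 := mul_le_mul_of_nonneg_left (h3.trans hmono) hω0.le
    refine le_trans (le_of_eq ?_) h4
    ring
  have htend : Filter.Tendsto (slope Φ Vinf) (nhdsWithin Vinf (Ioi Vinf)) (nhds (deriv Φ Vinf)) :=
    (hasDerivAt_iff_tendsto_slope.1 hdiff.hasDerivAt).mono_left
      (nhdsWithin_mono _ fun x hx => (ne_of_gt hx : x ≠ Vinf))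
  have hge := ge_of_tendsto htend (Filter.eventually_of_mem
    (Ioo_mem_nhdsGT (show Vinf < Vinf + ε by linarith)) hslope)
  have : 0 < ω * (ε * (ε * (a₀ Vinf / 2))) := by positivity
  linarith

end Gas

/-- For short intervals the extreme slopes are close to the slope at the centre. -/
theorem exists_slope_bounds {F : ℝ → ℝ} {V γ₀ : ℝ} (hγ₀ : 0 < γ₀)
    (hF : ContDiffOn ℝ 1 F (Ioo (V - γ₀) (V + γ₀))) (hpos : 0 < deriv F V) :
    ∃ γ₁ : ℝ, 0 < γ₁ ∧ ∀ γ, 0 < γ → γ < γ₁ → 0 < maxSlope F V γ ∧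
      maxSlope F V γ ≤ 2 * deriv F V ∧ deriv F V / 2 ≤ minSlope F V γ := by
  have hc : ContinuousAt (deriv F) V :=
    (hF.continuousOn_deriv_of_isOpen isOpen_Ioo le_rfl).continuousAt
      (Ioo_mem_nhds (by linarith) (by linarith))
  obtain ⟨γ₁, hγ₁, hball⟩ := Metric.continuousAt_iff.1 hc (deriv F V / 2) (by linarith)
  refine ⟨γ₁, hγ₁, fun γ hγ hγ' => ?_⟩
  have hb : ∀ x ∈ Icc (V - γ) (V + γ), deriv F V / 2 ≤ deriv F x ∧ deriv F x ≤ 2 * deriv F V := by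
    intro x hx
    have hx' : dist x V < γ₁ := by
      rw [Real.dist_eq, abs_lt]
      constructor <;> linarith [hx.1, hx.2]
    have := hball hx'
    rw [Real.dist_eq, abs_lt] at this
    constructor <;> linarith
  have hV : V ∈ Icc (V - γ) (V + γ) := ⟨by linarith, by linarith⟩
  have hne : (deriv F '' Icc (V - γ) (V + γ)).Nonempty := ⟨_, mem_image_of_mem _ hV⟩
  refine ⟨hpos.trans_le ?_, csSup_le hne ?_, le_csInf hne ?_⟩
  · refine le_csSup ⟨2 * deriv F V, ?_⟩ (mem_image_of_mem _ hV)
    rintro _ ⟨x, hx, rfl⟩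
    exact (hb x hx).2
  · rintro _ ⟨x, hx, rfl⟩
    exact (hb x hx).2
  · rintro _ ⟨x, hx, rfl⟩
    exact (hb x hx).1

/-! ### Motions of the reversal class -/

theorem ReversalClass.reversingMotion {F : ℝ → ℝ} {p q Vinf γ K₀ Aplus Aminus B β : ℝ}
    {W : ℝ → ℝ} (hW : ReversalClass F p q Vinf γ K₀ Aplus Aminus W) (hγ : 0 < γ)
    (hA : 0 < Aminus) (hB : maxSlope F Vinf γ ≤ B) (hβ : β ≤ minSlope F Vinf γ) :
    ReversingMotion B β q Vinf γ (γ ^ p * Aplus) (K₀ * |Real.log γ|) W where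
  continuousOn := by
    obtain ⟨L, hL⟩ := hW.lipschitz
    exact hL.continuousOn
  lower t ht := by
    refine le_trans ?_ (hW.lower t ht)
    have : Real.exp (-B * t) ≤ Real.exp (-maxSlope F Vinf γ * t) :=
      Real.exp_le_exp.2 (by nlinarith)
    gcongr
  upper t ht := by
    refine (hW.upper t ht).trans ?_
    have h1 : Real.exp (-minSlope F Vinf γ * t) ≤ Real.exp (-β * t) :=
      Real.exp_le_exp.2 (by nlinarith)
    have h2 : 0 ≤ γ ^ p * Aminus / t ^ q * chi (K₀ * |Real.log γ| + 1) t := by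
      refine mul_nonneg (by positivity) ?_
      unfold chi
      split_ifs <;> norm_num
    have := mul_le_mul_of_nonneg_left
      (show Real.exp (-minSlope F Vinf γ * t)
        - γ ^ p * Aminus / t ^ q * chi (K₀ * |Real.log γ| + 1) t ≤ Real.exp (-β * t) by linarith)
      hγ.le
    linarith
  decreasing := hW.decreasing

end

theorem mainTheorem4 (d : ℕ) (hd : 1 ≤ d) (r : ℝ) (hr : 0 < r)
    (k : ℝ → ℝ → ℝ) (a₀ : ℝ → ℝ) (b : Perp d → ℝ) (p Vinf γ₀ : ℝ)
    (hVinf : 0 ≤ Vinf) (hγ₀ : 0 < γ₀)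
    (hgas : GasAssumptions k a₀ b p Vinf γ₀)
    (hF_finite : ∀ V ∈ Set.Ioo (Vinf - γ₀) (Vinf + γ₀), MeasureTheory.Integrable
      (fun u : Vel d => ell (collisionKernel k b) (u - horiz d V) * initialDensity a₀ b u))
    (hF_C1 : ContDiffOn ℝ 1 (freeForce (collisionKernel k b) (initialDensity a₀ b) r)
      (Set.Ioo (Vinf - γ₀) (Vinf + γ₀)))
    (hrev : ReversalCriterion k a₀ Vinf) :
    ∃ c₁ C₂ C ε : ℝ, 0 < c₁ ∧ 0 < C₂ ∧ 0 < C ∧ 0 < ε ∧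
      ∀ Aplus Aminus : ℝ, 0 < Aplus → 0 < Aminus →
        ∃ γ₁ : ℝ, 0 < γ₁ ∧ ∀ γ : ℝ, 0 < γ → γ < γ₁ → ∀ (K₀ : ℝ) (W : ℝ → ℝ),
          ReversalClass (freeForce (collisionKernel k b) (initialDensity a₀ b) r)
            p (p + d) Vinf γ K₀ Aplus Aminus W →
          ∀ t : ℝ, 0 ≤ t →
            (∀ e : Side, MeasureTheory.IntegrableOn
              (fun z : Perp d × Vel d =>
                forceIntegrand (collisionKernel k b) (initialDensity a₀ b) r W e t z.1 z.2)
              (Metric.closedBall (0 : Perp d) r ×ˢ e.incoming d (W t))) ∧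
            (c₁ * γ ^ (p + 1) / t ^ (p + d)
                - C₂ * γ ^ ((1 + ε) * (p + 1)) * Aplus ^ (p + 1) / t ^ (p + d))
                  * chi (K₀ * |Real.log γ|) t
              ≤ precollisionForce (collisionKernel k b) (initialDensity a₀ b) r W t ∧
            0 ≤ (c₁ * γ ^ (p + 1) / t ^ (p + d)
                - C₂ * γ ^ ((1 + ε) * (p + 1)) * Aplus ^ (p + 1) / t ^ (p + d))
                  * chi (K₀ * |Real.log γ|) t ∧
            precollisionForce (collisionKernel k b) (initialDensity a₀ b) r W t
              ≤ C * (γ + γ ^ (p + 1) * Aplus) ^ (p + 1) / (1 + t) ^ (p + d) := by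
  have hp := hgas.p_pos
  have ha : 0 < a₀ Vinf := lt_of_le_of_lt (setIntegral_nonneg measurableSet_Ioi fun z _ =>
    mul_nonneg (hgas.k_nonneg 0 z) (hgas.a₀_nonneg (z + Vinf))) hrev
  set Φ := freeForce (collisionKernel k b) (initialDensity a₀ b) r with hΦ
  have hpos : 0 < deriv Φ Vinf := hgas.deriv_freeForce_pos hγ₀ hr ha hF_finite
    ((hF_C1.differentiableOn one_ne_zero).differentiableAt
      (Ioo_mem_nhds (by linarith) (by linarith)))
  obtain ⟨γ₂, hγ₂, hslope⟩ := exists_slope_bounds hγ₀ hF_C1 hpos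
  set β := deriv Φ Vinf with hβ
  obtain ⟨c, C, γ₃, θ₁, T, hc, hC, hγ₃, hθ₁, hT, hmain⟩ :=
    exists_precollisionForce_bounds hd hr hγ₀ hgas hrev
      (show 0 < 2 * β by linarith) (show 0 < β / 2 by linarith)
  refine ⟨c, 1, C, 1, hc, one_pos, hC, one_pos, fun Aplus Aminus hAp hAm => ?_⟩
  -- the bounds on `γ` give in turn the slopes, the size of the perturbation, the length of the
  -- initial interval, the smallness of `θ`, and the sign of the lower bound
  refine ⟨min (min γ₂ γ₃) (min (Real.exp (-(2 * β * T)))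
    (min ((θ₁ / Aplus) ^ (1 / p)) (c ^ (1 / (p + 1)) / Aplus))), by positivity, ?_⟩
  intro γ hγ hγ1 K₀ W hW t ht
  obtain ⟨⟨l1, l2⟩, l3, l4, l5⟩ : (γ < γ₂ ∧ γ < γ₃) ∧ γ < Real.exp (-(2 * β * T)) ∧
      γ < (θ₁ / Aplus) ^ (1 / p) ∧ γ < c ^ (1 / (p + 1)) / Aplus := by
    simpa only [lt_min_iff] using hγ1
  obtain ⟨s1, s2, s3⟩ := hslope γ hγ l1
  have hθ : γ ^ p * Aplus ≤ θ₁ := by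
    have := Real.rpow_le_rpow hγ.le l4.le hp.le
    rw [← Real.rpow_mul (by positivity), one_div_mul_cancel hp.ne', Real.rpow_one] at this
    rwa [le_div_iff₀ hAp] at this
  have ht₀ : T ≤ K₀ * |Real.log γ| := by
    have h1 : Real.log γ < -(2 * β * T) := by
      rwa [Real.log_lt_iff_lt_exp hγ]
    have h2 : 2 * β * T ≤ |Real.log γ| := by
      rw [abs_of_neg (by nlinarith)]
      linarith
    have h3 : 1 / (2 * β) ≤ K₀ := (one_div_le_one_div_of_le s1 s2).trans hW.K₀_lower
    calc T = 1 / (2 * β) * (2 * β * T) := by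
          field_simp
      _ ≤ K₀ * |Real.log γ| := by
          have : 0 ≤ 1 / (2 * β) := by positivity
          exact mul_le_mul h3 h2 (by positivity) (this.trans h3)
  have hsign : γ ^ ((1 + 1) * (p + 1)) * Aplus ^ (p + 1) ≤ c * γ ^ (p + 1) := by
    rw [lt_div_iff₀ hAp] at l5
    have := Real.rpow_le_rpow (by positivity) l5.le (by linarith : 0 ≤ p + 1)
    rw [← Real.rpow_mul hc.le, one_div_mul_cancel (by linarith), Real.rpow_one,
      Real.mul_rpow hγ.le hAp.le] at this
    rw [show (1 + 1) * (p + 1) = (p + 1) + (p + 1) by ring, Real.rpow_add hγ]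
    have := mul_le_mul_of_nonneg_right this (Real.rpow_nonneg hγ.le (p + 1))
    linarith
  obtain ⟨hint, hneg, hlow, hup⟩ := hmain γ (γ ^ p * Aplus) (K₀ * |Real.log γ|) W hγ l2.le
    (by positivity) hθ ht₀ (hW.reversingMotion hγ hAm s2 s3) t ht
  have htq : 0 ≤ t ^ (p + (d : ℝ)) := Real.rpow_nonneg ht _
  have hsub : 0 ≤ c * γ ^ (p + 1) / t ^ (p + (d : ℝ))
      - 1 * γ ^ ((1 + 1) * (p + 1)) * Aplus ^ (p + 1) / t ^ (p + (d : ℝ)) := by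
    rw [← sub_div, one_mul]
    exact div_nonneg (sub_nonneg.2 hsign) htq
  have hsub0 : 0 ≤ 1 * γ ^ ((1 + 1) * (p + 1)) * Aplus ^ (p + 1) / t ^ (p + (d : ℝ)) := by
    positivity
  refine ⟨hint, ?_, mul_nonneg hsub ?_, hup.trans ?_⟩
  · unfold chi
    split_ifs with htt
    · rw [mul_one]
      linarith [hlow htt]
    · rw [mul_zero]
      exact hneg (not_le.1 htt)
  · unfold chi
    split_ifs <;> norm_num
  · have h1 : γ ≤ γ + γ ^ (p + 1) * Aplus := le_add_of_nonneg_right (by positivity)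
    gcongr
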